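/- **Setting.** Let $\mathbb D=\{|z|<1\}$, $\mathbb A_r=\{r<|z|<1\}$ and $C_r=\{|z|=r\}$ for $0<r<1$. For $D\ge 2$, let $\boldsymbol B^{\rm fc}_D$ be the space of Blaschke products $$\beta(z)=\prod_{k=1}^{D}\frac{1-\bar a_k}{1-a_k}\prod_{k=1}^{D}\frac{z-a_k}{1-\bar a_kz},\qquad a_1,\dots,a_D\in\mathbb D,$$ (so that $\beta(1)=1$) with $\beta(0)=0$, and let $\boldsymbol B^{\rm zc}_D$ be the space of those for which $0$ is the conformal barycenter of the zeros $a_1,\dots,a_D$, that is, there is a conformal automorphism $\varphi$ of $\mathbb D$ with $\varphi(0)=0$ and $\varphi(a_1)+\cdots+\varphi(a_D)=0$. Both carry the topology of locally uniform convergence on $\mathbb D$. For integers $e>\delta>0$, let $\boldsymbol A(e,\delta)$ be the set of all proper holomorphic maps $m:\mathbb A_r\to\mathbb D$, with $r\in(0,1)$ varying, such that $\deg(m)=e$, $\deg(m|_{C_r})=\delta$ and $m(1)=1$ (for the continuous extension of $m$ to the boundary). Its topology is the one in which $m_k:\mathbb A_{r_k}\to\mathbb D$ converges to $m:\mathbb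 A_r\to\mathbb D$ if $r_k\to r$ and $m_k\to m$ uniformly on every compact subset of $\mathbb A_r$. Let $n\ge1$, let $\boldsymbol d=(d_1,\dots,d_{n+1})$ be a vector of positive integers with $\sum_{k=1}^{n+1}1/d_k<1$, and put $d=d_1+\cdots+d_{n+1}$. Let $(\epsilon_1,\dots,\epsilon_n)\in\{+,-\}^n$, and put $\delta_k=d_k$ if $\epsilon_k=+$ and $\delta_k=d_{k+1}$ if $\epsilon_k=-$. For $\sigma\in\{I,II,III\}$ the model space is the topological product $$\mathbf M_\sigma=\boldsymbol B^{\rm fc}_{d_1}\times \boldsymbol B^{*}_{d_{n+1}}\times\prod_{k=1}^{n}\boldsymbol A(d_k+d_{k+1},\delta_k),$$ where $\boldsymbol B^{*}=\boldsymbol B^{\rm zc}$ if $\sigma=I$ and $\boldsymbol B^{*}=\boldsymbol B^{\rm fc}$ if $\sigma=II$ or $III$. **Statement.** The model space $\mathbf M_\sigma$ is homeomorphic to $\mathbb R^{4d-4-n}\times\mathbb T^n$, where $\mathbb T^n=(S^1)^n$. Moreover its factors satisfy $\boldsymbol B^{\rm fc}_{d_1}\cong\mathbb R^{2d_1-2}$,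 $\boldsymbol B^{*}_{d_{n+1}}\cong\mathbb R^{2d_{n+1}-2}$ and, for $1\le k\le n$, $\boldsymbol A(d_k+d_{k+1},\delta_k)\cong\mathbb R^{2(d_k+d_{k+1})-1}\times S^1$. -/

import Mathlib

open Complex Set Filter Topology
open scoped ComplexConjugate Complex.UnitDisc

namespace CantorCircle

/-! ### Blaschke products of the disk -/

/-- The Blaschke product with zeros `a₁, …, a_D` in the unit disk, normalized to send the boundary
point `1` to `1`. -/
noncomputable def blaschke {D : ℕ} (a : Fin D → 𝔻) (z : ℂ) : ℂ :=
  (∏ k, (1 - conj (a k : ℂ)) / (1 - (a k : ℂ))) *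
    ∏ k, (z - (a k : ℂ)) / (1 - conj (a k : ℂ) * z)

/-- `c` is the conformal barycenter of the points `p₁, …, p_D` of the unit disk: some conformal
automorphism `φ` of the disk (with inverse `ψ`) sends `c` to `0` and the `p_k` to points whose sum
is `0`. -/
def IsConformalBarycenter {D : ℕ} (c : 𝔻) (p : Fin D → 𝔻) : Prop :=
  ∃ φ ψ : ℂ → ℂ,
    DifferentiableOn ℂ φ (Metric.ball 0 1) ∧ DifferentiableOn ℂ ψ (Metric.ball 0 1) ∧
    MapsTo φ (Metric.ball 0 1) (Metric.ball 0 1) ∧ MapsTo ψ (Metric.ball 0 1) (Metric.ball 0 1) ∧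
    InvOn ψ φ (Metric.ball 0 1) (Metric.ball 0 1) ∧
    φ c = 0 ∧ ∑ k, φ (p k) = 0

/-- The space of fixed point centered Blaschke products of degree `D` fixing the boundary
point `1`. As a subset of `C(𝔻, 𝔻)` it carries the compact-open topology, that is, the topology of
locally uniform convergence on the disk. -/
def BlaschkeFC (D : ℕ) : Set C(𝔻, 𝔻) :=
  {β | (∃ a : Fin D → 𝔻, ∀ z : 𝔻, (β z : ℂ) = blaschke a z) ∧ β 0 = 0}

/-- The space of zero centered Blaschke products of degree `D` fixing the boundary point `1`
(`0` is the conformal barycenter of the zeros, counted with multiplicity), with the compact-open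
topology. -/
def BlaschkeZC (D : ℕ) : Set C(𝔻, 𝔻) :=
  {β | ∃ a : Fin D → 𝔻, (∀ z : 𝔻, (β z : ℂ) = blaschke a z) ∧ IsConformalBarycenter 0 a}

/-! ### Annulus-disk mappings -/

/-- The open annulus `𝔸_r = {z : r < |z| < 1}`. -/
def annulus (r : ℝ) : Set ℂ := {z | r < ‖z‖ ∧ ‖z‖ < 1}

/-- The number of zeros of `f` in `𝔸_r`, counted with multiplicity. For a proper holomorphic map
`f : 𝔸_r → 𝔻` this is the mapping degree of `f` (every fibre has the same number of points,
counted with multiplicity). -/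
noncomputable def zeroCount (r : ℝ) (f : ℂ → ℂ) : ℕ :=
  ∑ᶠ z ∈ annulus r, analyticOrderNatAt f z

/-- The continuous extension of `f : 𝔸_r → 𝔻` to the inner boundary circle `C_r` takes values in
the unit circle and has degree `δ` as a map `C_r → S¹`. Here `C_r` is oriented as a boundary
component of `𝔸_r`, that is, clockwise; `θ` is a lift of the boundary map. -/
def HasInnerDegree (r : ℝ) (f : ℂ → ℂ) (δ : ℕ) : Prop :=
  ∃ θ : ℝ → ℝ, Continuous θ ∧
    (∀ t : ℝ, Tendsto f (𝓝[annulus r] (r * exp (-(t * I)))) (𝓝 (exp (θ t * I)))) ∧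
    ∀ t : ℝ, θ (t + 2 * Real.pi) = θ t + 2 * Real.pi * δ

/-- The set `A(e, δ)` of all proper holomorphic maps `m : 𝔸_r → 𝔻`, with `r ∈ (0, 1)` varying, of
degree `e`, of degree `δ` on the inner boundary circle, and with `m(1) = 1` (in the sense of the
boundary value). A map on `𝔸_r` is recorded as a function on `ℂ` that is `0` off `𝔸_r`, so that two
elements are equal exactly if they have the same annulus and the same values on it. -/
structure AnnulusDiskMap (e δ : ℕ) where
  r : ℝ
  r_pos : 0 < r
  r_lt_one : r < 1
  toFun : ℂ → ℂ
  eq_zero_of_notMem : ∀ z, z ∉ annulus r → toFun z = 0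
  holomorphic : DifferentiableOn ℂ toFun (annulus r)
  mapsTo : MapsTo toFun (annulus r) (Metric.ball 0 1)
  proper : ∀ K : Set ℂ, K ⊆ Metric.ball 0 1 → IsCompact K → IsCompact (annulus r ∩ toFun ⁻¹' K)
  degree_eq : zeroCount r toFun = e
  innerDegree_eq : HasInnerDegree r toFun δ
  map_one : Tendsto toFun (𝓝[annulus r] 1) (𝓝 1)

namespace AnnulusDiskMap

variable {e δ : ℕ}

/-- The maps `ψ` that are defined on `K` and are `ε`-close to `φ` there, and whose annulus is
`ε`-close to that of `φ`. -/
def nbhd (φ : AnnulusDiskMap e δ) (K : Set ℂ) (ε : ℝ) : Set (AnnulusDiskMap e δ) :=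
  {ψ | |ψ.r - φ.r| < ε ∧ K ⊆ annulus ψ.r ∧ ∀ z ∈ K, ‖ψ.toFun z - φ.toFun z‖ < ε}

/-- The topology of `A(e, δ)`: convergence of `r` together with uniform convergence on every compact
subset of the limit annulus (see `tendsto_iff`). -/
instance : TopologicalSpace (AnnulusDiskMap e δ) where
  IsOpen U := ∀ φ ∈ U, ∃ K : Set ℂ, IsCompact K ∧ K ⊆ annulus φ.r ∧ ∃ ε > 0, nbhd φ K ε ⊆ U
  isOpen_univ := fun φ _ => ⟨∅, isCompact_empty, empty_subset _, 1, one_pos, subset_univ _⟩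
  isOpen_inter := by
    rintro U V hU hV φ ⟨hφU, hφV⟩
    obtain ⟨K, hK, hKs, ε, hε, h⟩ := hU φ hφU
    obtain ⟨L, hL, hLs, η, hη, h'⟩ := hV φ hφV
    refine ⟨K ∪ L, hK.union hL, union_subset hKs hLs, min ε η, lt_min hε hη, ?_⟩
    rintro ψ ⟨h1, h2, h3⟩
    exact ⟨h ⟨h1.trans_le (min_le_left _ _), subset_union_left.trans h2,
        fun z hz => (h3 z (Or.inl hz)).trans_le (min_le_left _ _)⟩,
      h' ⟨h1.trans_le (min_le_right _ _), subset_union_right.trans h2,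
        fun z hz => (h3 z (Or.inr hz)).trans_le (min_le_right _ _)⟩⟩
  isOpen_sUnion := by
    rintro S hS φ ⟨U, hU, hφ⟩
    obtain ⟨K, hK, hKs, ε, hε, h⟩ := hS U hU φ hφ
    exact ⟨K, hK, hKs, ε, hε, h.trans (subset_sUnion_of_mem hU)⟩

theorem isOpen_annulus (r : ℝ) : IsOpen (annulus r) :=
  (isOpen_lt continuous_const continuous_norm).inter (isOpen_lt continuous_norm continuous_const)

theorem isOpen_nbhd (φ : AnnulusDiskMap e δ) {K : Set ℂ} (hK : IsCompact K)
    (hKφ : K ⊆ annulus φ.r) (ε : ℝ) : IsOpen (nbhd φ K ε) := by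
  rintro ψ ⟨h1, h2, h3⟩
  obtain ⟨s, hs, hsε⟩ : ∃ s < ε, ∀ z ∈ K, ‖ψ.toFun z - φ.toFun z‖ ≤ s := by
    rcases K.eq_empty_or_nonempty with rfl | hne
    · exact ⟨ε - 1, by linarith, by simp⟩
    · have hc : ContinuousOn (fun z => ‖ψ.toFun z - φ.toFun z‖) K :=
        ((ψ.holomorphic.continuousOn.mono h2).sub (φ.holomorphic.continuousOn.mono hKφ)).norm
      obtain ⟨z, hz, hmax⟩ := hK.exists_isMaxOn hne hc
      exact ⟨_, h3 z hz, fun w hw => hmax hw⟩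
  refine ⟨K, hK, h2, min (ε - |ψ.r - φ.r|) (ε - s),
    lt_min (by linarith) (by linarith), ?_⟩
  rintro χ ⟨g1, g2, g3⟩
  refine ⟨?_, g2, fun z hz => ?_⟩
  · have := g1.trans_le (min_le_left _ _)
    have := abs_sub_le χ.r ψ.r φ.r
    linarith
  · have := (g3 z hz).trans_le (min_le_right _ _)
    have := norm_sub_le_norm_sub_add_norm_sub (χ.toFun z) (ψ.toFun z) (φ.toFun z)
    have := hsε z hz
    linarith

/-- A compact subset of the annulus of `φ` lies in the annulus of every `ψ` with `r_ψ` close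
to `r_φ`. -/
theorem exists_subset_annulus {r : ℝ} {K : Set ℂ} (hK : IsCompact K) (hKr : K ⊆ annulus r) :
    ∃ η > 0, ∀ s : ℝ, |s - r| < η → K ⊆ annulus s := by
  rcases K.eq_empty_or_nonempty with rfl | hne
  · exact ⟨1, one_pos, by simp⟩
  · obtain ⟨z, hz, hmin⟩ := hK.exists_isMinOn hne continuous_norm.continuousOn
    refine ⟨‖z‖ - r, sub_pos.2 (hKr hz).1, fun s hs w hw => ⟨?_, (hKr hw).2⟩⟩
    have h1 : ‖z‖ ≤ ‖w‖ := hmin hw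
    have h2 := (abs_lt.1 hs).2
    linarith

/-- Convergence in `A(e, δ)` is convergence of `r` and uniform convergence on the compact subsets of
the limit annulus. -/
theorem tendsto_iff {ι : Type*} {l : Filter ι} (u : ι → AnnulusDiskMap e δ)
    (φ : AnnulusDiskMap e δ) :
    Tendsto u l (𝓝 φ) ↔ Tendsto (fun i => (u i).r) l (𝓝 φ.r) ∧
      ∀ K : Set ℂ, IsCompact K → K ⊆ annulus φ.r →
        (∀ᶠ i in l, K ⊆ annulus (u i).r) ∧
          TendstoUniformlyOn (fun i => (u i).toFun) φ.toFun l K := by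
  constructor
  · intro h
    have key : ∀ K : Set ℂ, IsCompact K → K ⊆ annulus φ.r → ∀ ε > 0, ∀ᶠ i in l,
        u i ∈ nbhd φ K ε := fun K hK hKφ ε hε =>
      h ((isOpen_nbhd φ hK hKφ ε).mem_nhds ⟨by simpa using hε, hKφ, by simpa using fun _ _ => hε⟩)
    refine ⟨Metric.tendsto_nhds.2 fun ε hε => ?_, fun K hK hKφ => ⟨?_, ?_⟩⟩
    · filter_upwards [key ∅ isCompact_empty (empty_subset _) ε hε] with i hi
      rw [Real.dist_eq]
      exact hi.1
    · filter_upwards [key K hK hKφ 1 one_pos] with i hi using hi.2.1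
    · refine Metric.tendstoUniformlyOn_iff.2 fun ε hε => ?_
      filter_upwards [key K hK hKφ ε hε] with i hi z hz
      rw [dist_comm, dist_eq_norm]
      exact hi.2.2 z hz
  · rintro ⟨hr, hu⟩
    refine tendsto_nhds.2 fun U hU hφ => ?_
    obtain ⟨K, hK, hKφ, ε, hε, hsub⟩ := hU φ hφ
    filter_upwards [Metric.tendsto_nhds.1 hr ε hε, (hu K hK hKφ).1,
      Metric.tendstoUniformlyOn_iff.1 (hu K hK hKφ).2 ε hε] with i h1 h2 h3
    refine hsub ⟨by rwa [Real.dist_eq] at h1, h2, fun z hz => ?_⟩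
    rw [← dist_eq_norm, dist_comm]
    exact h3 z hz

end AnnulusDiskMap

/-! ### The model space -/

/-- The three types of mapping schemes. -/
inductive SchemeType
  | I
  | II
  | III

/-- The two values of an entry of the characteristic of a boundary marking: the marked point of the
annular Fatou component `D_k` lies on the side of `A_{k+1}` (`plus`) or of `A_k` (`minus`). -/
inductive Side
  | plus
  | minus

/-- A vector `(d₁, …, d_{n+1})` of positive integers is admissible if `∑ 1 / d_k < 1`. The indices
start from `0` here, so that `d_{k+1}` is `d k`. -/
def Admissible {n : ℕ} (d : Fin (n + 1) → ℕ) : Prop :=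
  (∀ k, 0 < d k) ∧ ∑ k, (1 : ℝ) / d k < 1

/-- The inner boundary degrees `δ_k`: `d_k` if `ε_k = +`, and `d_{k+1}` if `ε_k = -`. For `k : Fin n`,
`d k.castSucc` and `d k.succ` are the entries before and after the `k`-th annular component. -/
def innerDegree {n : ℕ} (d : Fin (n + 1) → ℕ) (χ : Fin n → Side) (k : Fin n) : ℕ :=
  match χ k with
  | .plus => d k.castSucc
  | .minus => d k.succ

/-- The space in which the model map at infinity varies: zero centered Blaschke products for type
I, fixed point centered ones for types II and III. -/
def BlaschkeAtInfinity : SchemeType → ℕ → Set C(𝔻, 𝔻)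
  | .I, D => BlaschkeZC D
  | .II, D => BlaschkeFC D
  | .III, D => BlaschkeFC D

/-- The model space `M_σ`, with the product topology. -/
abbrev ModelSpace (σ : SchemeType) {n : ℕ} (d : Fin (n + 1) → ℕ) (χ : Fin n → Side) : Type :=
  BlaschkeFC (d 0) × BlaschkeAtInfinity σ (d (Fin.last n)) ×
    (∀ k : Fin n, AnnulusDiskMap (d k.castSucc + d k.succ) (innerDegree d χ k))

end CantorCircle

/-!
A Blaschke product, or a proper map from an annulus to the disk, is determined up to rotation by
its unordered tuple of zeros, and the normalization at the boundary point `1` removes the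
rotation. Each factor of the model space is therefore the quotient by the symmetric group of a set
of ordered tuples of zeros, and the problem is to identify that set, equivariantly, with one whose
quotient is known.

*Which zeros occur.* For Blaschke products with `β(0) = 0` the condition is `∏ aₖ = 0`; for those
with barycenter `0` it is `∑ aₖ = 0`, because by the Schwarz lemma the automorphisms of the disk
fixing `0` are rotations (`isConformalBarycenter_zero_iff`). For annuli, the zeros lie in `𝔸_r`
and satisfy `∏ |aₖ| = r ^ δ`. Indeed quotients of theta functions give functions on `𝔸_r` with a
single prescribed zero and constant modulus on each boundary circle (`annulusFactor`). Dividing a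
proper map by those for its zeros leaves a zero-free function with constant boundary moduli, which
must be a monomial (`eq_zpow_of_tendsto`), and the exponent is `-δ`
(`AnnulusDiskMap.exists_eq_annulusProduct`). Conversely such products are proper maps
(`mapOfZeros`).

*Topology.* The maps from tuples of zeros to functions are proper (`isProperMap_blaschkeOfZeros`,
`isProperMap_mapOfZeros`): along an ultrafilter the zeros converge in the closed disk, the product
formula passes to the limit, and a limit of the same degree leaves no room for zeros on the
boundary (`HasZeros.isRearrangement`). Proper surjections are quotient maps, so the function
spaces carry the quotient topology. The same holds for the map from tuples in `ℂ` to the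
coefficients of the monic polynomial with these roots (`isProperMap_coeffsOfRoots`).

*Equivariant straightening.* The cones `∏ aₖ = 0` and `∑ aₖ = 0` in the unit ball of the sup norm
are expanded radially to the full cones (`unitBallConeHomeomorph`); their quotients are the
coefficient vectors with vanishing constant, respectively subleading, coefficient. For annuli the
numbers `log |aₖ| / log r` form a point of the slice `∑ yₖ = δ` of the cube `(0, 1) ^ e`, which is
expanded radially to the hyperplane `∑ tₖ = 0` (`annulusZerosHomeomorph`). With `r` as a free
parameter the quotient becomes `ℝ` times the set of coefficient vectors with constant coefficient
of modulus `1`, that is, `ℝ × S¹ × ℂ ^ (e - 1)`.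
-/

namespace CantorCircle

/-! ### Unordered tuples -/

/-- Two tuples are rearrangements of each other if they differ by a permutation of the indices, so
that they represent the same unordered tuple. -/
def IsRearrangement {m : ℕ} {α : Type*} (a b : Fin m → α) : Prop :=
  ∃ σ : Equiv.Perm (Fin m), a = b ∘ σ

theorem IsRearrangement.prod_eq {m : ℕ} {α M : Type*} [CommMonoid M] {a b : Fin m → α}
    (h : IsRearrangement a b) (f : α → M) : ∏ k, f (a k) = ∏ k, f (b k) := by
  obtain ⟨σ, rfl⟩ := h
  exact Equiv.prod_comp σ fun k => f (b k)

/-- Tuples taking each value equally often are rearrangements of each other. -/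
theorem isRearrangement_of_card_eq {m : ℕ} {α : Type*} [DecidableEq α] {a b : Fin m → α}
    (h : ∀ z, (Finset.univ.filter fun k => a k = z).card =
      (Finset.univ.filter fun k => b k = z).card) : IsRearrangement a b := by
  have e : ∀ z, Nonempty ({k // a k = z} ≃ {k // b k = z}) := fun z => by
    refine ⟨Fintype.equivOfCardEq ?_⟩
    rw [Fintype.card_subtype, Fintype.card_subtype, h z]
  refine ⟨Equiv.ofFiberEquiv fun z => (e z).some, funext fun k => ?_⟩
  exact (Equiv.ofFiberEquiv_map (fun z => (e z).some) k).symm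

open Polynomial in
/-- The tuple of non-leading coefficients of the monic polynomial with the given roots. -/
noncomputable def coeffsOfRoots {m : ℕ} (a : Fin m → ℂ) (i : Fin m) : ℂ :=
  (∏ k, (X - C (a k))).coeff i

open Polynomial in
theorem continuous_coeffsOfRoots {m : ℕ} : Continuous (coeffsOfRoots (m := m)) := by
  have key : ∀ (s : Finset (Fin m)) (i : ℕ),
      Continuous fun a : Fin m → ℂ => (∏ k ∈ s, (X - C (a k))).coeff i := by
    intro s
    induction s using Finset.induction_on with
    | empty => intro i; simpa using continuous_const
    | insert k s hk ih =>
      intro i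
      simp only [Finset.prod_insert hk, sub_mul, coeff_sub, coeff_C_mul]
      refine Continuous.sub ?_ ((continuous_apply k).mul (ih i))
      cases i with
      | zero => simpa using continuous_const
      | succ i => simpa using ih i
  exact continuous_pi fun i => key _ i

open Polynomial in
theorem natDegree_prod_univ_X_sub_C {m : ℕ} (a : Fin m → ℂ) :
    (∏ k, (X - C (a k))).natDegree = m := by
  rw [natDegree_prod_of_monic _ _ fun k _ => monic_X_sub_C _]
  simp

open Polynomial in
theorem monic_eq_of_coeff_eq {m : ℕ} {p q : ℂ[X]} (hp : p.Monic) (hq : q.Monic)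
    (hpm : p.natDegree = m) (hqm : q.natDegree = m) (h : ∀ i : Fin m, p.coeff i = q.coeff i) :
    p = q := by
  ext i
  rcases lt_trichotomy i m with hi | rfl | hi
  · exact h ⟨i, hi⟩
  · have h1 := hp.coeff_natDegree
    have h2 := hq.coeff_natDegree
    rw [hpm] at h1
    rw [hqm] at h2
    rw [h1, h2]
  · rw [coeff_eq_zero_of_natDegree_lt (hpm ▸ hi), coeff_eq_zero_of_natDegree_lt (hqm ▸ hi)]

open Polynomial in
theorem coeffsOfRoots_eq_iff {m : ℕ} {a b : Fin m → ℂ} :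
    coeffsOfRoots a = coeffsOfRoots b ↔ IsRearrangement a b := by
  classical
  constructor
  · intro h
    have h1 : ∏ k, (X - C (a k)) = ∏ k, (X - C (b k)) :=
      monic_eq_of_coeff_eq (monic_prod_of_monic _ _ fun k _ => monic_X_sub_C _)
        (monic_prod_of_monic _ _ fun k _ => monic_X_sub_C _) (natDegree_prod_univ_X_sub_C a)
        (natDegree_prod_univ_X_sub_C b) fun i => congrFun h i
    have h2 : ∀ c : Fin m → ℂ,
        (∏ k, (X - C (c k))).roots = Finset.univ.val.map c := fun c => by
      have := roots_multiset_prod_X_sub_C (Finset.univ.val.map c)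
      rw [Multiset.map_map] at this
      exact this
    have h3 : Finset.univ.val.map a = Finset.univ.val.map b := by rw [← h2, ← h2, h1]
    refine isRearrangement_of_card_eq fun z => ?_
    have := congrArg (Multiset.count z) h3
    simp only [Multiset.count_map] at this
    simpa [Finset.card_def, eq_comm] using this
  · intro h
    ext i
    unfold coeffsOfRoots
    rw [h.prod_eq fun z => X - C z]

open Polynomial in
theorem surjective_coeffsOfRoots {m : ℕ} : Function.Surjective (coeffsOfRoots (m := m)) := by
  intro c
  set p : ℂ[X] := X ^ m + ∑ i : Fin m, C (c i) * X ^ (i : ℕ) with hp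
  have hdeg : (∑ i : Fin m, C (c i) * X ^ (i : ℕ)).degree < (m : WithBot ℕ) :=
    degree_sum_fin_lt c
  have hmon : p.Monic := monic_X_pow_add hdeg
  have hnat : p.natDegree = m := by
    have : p.degree = m := by
      rw [hp, degree_add_eq_left_of_degree_lt (by simpa using hdeg)]; simp
    exact natDegree_eq_of_degree_eq_some this
  have hsplit := IsAlgClosed.splits p
  have hcard : p.roots.card = m := by rw [← hnat]; exact (splits_iff_card_roots.1 hsplit)
  have hroots : p.roots.toList.length = m := by simpa using hcard
  refine ⟨fun k => p.roots.toList.get (k.cast hroots.symm), ?_⟩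
  have hprod : ∏ k : Fin m, (X - C (p.roots.toList.get (k.cast hroots.symm))) = p := by
    refine Eq.trans ?_ (hsplit.eq_prod_roots_of_monic hmon).symm
    have h1 : (p.roots.map fun a => X - C a).prod
        = (p.roots.toList.map fun a => X - C a).prod := by
      conv_lhs => rw [← Multiset.coe_toList p.roots]
      rw [Multiset.map_coe, Multiset.prod_coe]
    rw [h1, ← Fin.prod_univ_fun_getElem]
    exact Fintype.prod_equiv (finCongr hroots.symm) _ _ fun k => by simp
  ext i
  unfold coeffsOfRoots
  rw [hprod, hp]
  simp [coeff_X_pow, i.2.ne]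
  rw [Finset.sum_eq_single i]
  · simp
  · intro b _ hb; simp [Fin.val_inj, hb.symm]
  · simp

open Polynomial in
/-- Roots are bounded in terms of the coefficients, so the passage from roots to coefficients is a
proper map; being closed, it is a quotient map, which expresses the continuity of roots. -/
theorem isProperMap_coeffsOfRoots {m : ℕ} : IsProperMap (coeffsOfRoots (m := m)) := by
  refine isProperMap_iff_isCompact_preimage.2 ⟨continuous_coeffsOfRoots, fun K hK => ?_⟩
  refine Metric.isCompact_of_isClosed_isBounded
    (hK.isClosed.preimage continuous_coeffsOfRoots) ?_
  obtain ⟨R, hR0, hR⟩ := hK.isBounded.exists_pos_norm_le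
  refine isBounded_iff_forall_norm_le.2 ⟨R + 1, fun a ha => ?_⟩
  refine (pi_norm_le_iff_of_nonneg (by linarith)).2 fun k => ?_
  set p : ℂ[X] := ∏ k, (X - C (a k)) with hp
  have hmon : p.Monic := monic_prod_of_monic _ _ fun k _ => monic_X_sub_C _
  have hroot : p.IsRoot (a k) := by
    rw [IsRoot.def, hp, eval_prod]
    exact Finset.prod_eq_zero (Finset.mem_univ k) (by simp)
  refine (NNReal.coe_lt_coe.2 (hroot.norm_lt_cauchyBound hmon.ne_zero)).le.trans ?_
  have : p.cauchyBound ≤ R.toNNReal + 1 := by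
    unfold cauchyBound
    simp only [hmon.leadingCoeff, nnnorm_one, div_one]
    gcongr
    refine Finset.sup_le fun i hi => ?_
    have hi' : i < m := by
      have := Finset.mem_range.1 hi
      rwa [hp, natDegree_prod_univ_X_sub_C] at this
    have h1 : ‖p.coeff i‖ ≤ R := 
      (norm_le_pi_norm (coeffsOfRoots a) ⟨i, hi'⟩).trans (hR _ ha)
    exact NNReal.coe_le_coe.1 (by simpa [hR0.le] using h1)
  have := NNReal.coe_le_coe.2 this
  simpa [hR0.le] using this

open Polynomial in
theorem coeffsOfRoots_zero {m : ℕ} (hm : 0 < m) (a : Fin m → ℂ) :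
    coeffsOfRoots a ⟨0, hm⟩ = ∏ k, -a k := by
  simp [coeffsOfRoots, coeff_zero_eq_eval_zero, eval_prod]

open Polynomial in
theorem coeffsOfRoots_last {m : ℕ} (hm : 0 < m) (a : Fin m → ℂ) :
    coeffsOfRoots a ⟨m - 1, by omega⟩ = -∑ k, a k := by
  have := prod_X_sub_C_coeff_card_pred Finset.univ a (by simpa using hm)
  simpa [coeffsOfRoots] using this

/-- Spaces that are quotients of homeomorphic spaces by corresponding relations are
homeomorphic. -/
theorem nonempty_homeomorph_of_isQuotientMap {S T X Y : Type*} [TopologicalSpace S]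
    [TopologicalSpace T] [TopologicalSpace X] [TopologicalSpace Y] {p : S → X} {q : T → Y}
    (hp : IsQuotientMap p) (hq : IsQuotientMap q) (h : S ≃ₜ T)
    (hpq : ∀ s s', p s = p s' ↔ q (h s) = q (h s')) : Nonempty (X ≃ₜ Y) := by
  have hp' : IsQuotientMap (⟨p, hp.continuous⟩ : C(S, X)) := hp
  have hq' : IsQuotientMap (⟨q ∘ h, hq.continuous.comp h.continuous⟩ : C(S, Y)) :=
    hq.comp h.isQuotientMap
  refine ⟨hp'.homeomorph.symm.trans (Homeomorph.trans ?_ hq'.homeomorph)⟩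
  exact Homeomorph.Quotient.congrRight fun s s' => hpq s s'

/-! ### Zeros of holomorphic functions -/

/-- `f` factors on `U` as `∏ (z - a k)` times a zero-free holomorphic function. The points `a k` may
lie outside `U`; those in `U` are the zeros of `f` there, counted with multiplicity. -/
def HasZeros {m : ℕ} (U : Set ℂ) (f : ℂ → ℂ) (a : Fin m → ℂ) : Prop :=
  ∃ G : ℂ → ℂ, DifferentiableOn ℂ G U ∧ (∀ z ∈ U, G z ≠ 0) ∧
    ∀ z ∈ U, f z = (∏ k, (z - a k)) * G z

theorem analyticOrderAt_sub_const (a z : ℂ) :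
    analyticOrderAt (fun w => w - a) z = if a = z then 1 else 0 := by
  split_ifs with h
  · subst h
    exact analyticOrderAt_id_sub_const_self
  · exact analyticOrderAt_id_sub_const_of_ne fun h' => h h'.symm

theorem analyticOrderAt_prod_sub {ι : Type*} [DecidableEq ι] (s : Finset ι) (a : ι → ℂ) (z : ℂ) :
    analyticOrderAt (fun w => ∏ k ∈ s, (w - a k)) z = (s.filter fun k => a k = z).card := by
  induction s using Finset.induction_on with
  | empty => simpa using analyticAt_const.analyticOrderAt_eq_zero.2 (one_ne_zero (α := ℂ))
  | insert k s hk ih =>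
    have h : (fun w => ∏ k ∈ insert k s, (w - a k)) =
        (fun w => w - a k) * fun w => ∏ k ∈ s, (w - a k) := by
      ext w
      simp [Finset.prod_insert hk]
    rw [h, analyticOrderAt_mul (by fun_prop) (by fun_prop), ih, analyticOrderAt_sub_const,
      Finset.filter_insert]
    split_ifs
    · rw [Finset.card_insert_of_notMem (by simp [hk])]
      push_cast
      rw [add_comm]
    · simp

theorem HasZeros.analyticOrderAt_eq {m : ℕ} {U : Set ℂ} {f : ℂ → ℂ} {a : Fin m → ℂ}
    (h : HasZeros U f a) (hU : IsOpen U) {z : ℂ} (hz : z ∈ U) :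
    analyticOrderAt f z = (Finset.univ.filter fun k => a k = z).card := by
  obtain ⟨G, hG, hG0, hf⟩ := h
  have hGa : AnalyticAt ℂ G z := hG.analyticAt (hU.mem_nhds hz)
  have hfe : f =ᶠ[𝓝 z] (fun w => ∏ k, (w - a k)) * G := by
    filter_upwards [hU.mem_nhds hz] with w hw using hf w hw
  rw [analyticOrderAt_congr hfe, analyticOrderAt_mul (by fun_prop) hGa,
    hGa.analyticOrderAt_eq_zero.2 (hG0 z hz), add_zero, analyticOrderAt_prod_sub]

theorem HasZeros.analyticOrderNatAt_eq {m : ℕ} {U : Set ℂ} {f : ℂ → ℂ} {a : Fin m → ℂ}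
    (h : HasZeros U f a) (hU : IsOpen U) {z : ℂ} (hz : z ∈ U) :
    analyticOrderNatAt f z = (Finset.univ.filter fun k => a k = z).card := by
  unfold analyticOrderNatAt
  rw [h.analyticOrderAt_eq hU hz]
  rfl

/-- The unordered tuple of zeros is determined by the function as soon as one of the two tuples
lies in the domain: it exhausts the zeros, so the other one cannot have points outside. -/
theorem HasZeros.isRearrangement {m : ℕ} {U : Set ℂ} {f : ℂ → ℂ} {a b : Fin m → ℂ}
    (ha : HasZeros U f a) (hb : HasZeros U f b) (hU : IsOpen U) (hbU : ∀ k, b k ∈ U) :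
    IsRearrangement a b := by
  have hcount : ∀ z ∈ U, (Finset.univ.filter fun k => a k = z).card =
      (Finset.univ.filter fun k => b k = z).card := fun z hz => by
    rw [← ha.analyticOrderNatAt_eq hU hz, hb.analyticOrderNatAt_eq hU hz]
  have haU : ∀ k, a k ∈ U := by
    set t := Finset.univ.image b with ht
    have htU : ∀ z ∈ t, z ∈ U := by
      intro z hz
      obtain ⟨k, -, rfl⟩ := Finset.mem_image.1 hz
      exact hbU k
    have h1 : (Finset.univ : Finset (Fin m)).card
        = ∑ z ∈ t, (Finset.univ.filter fun k => b k = z).card :=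
      Finset.card_eq_sum_card_fiberwise fun k _ => by simp [ht]
    have h2 : (Finset.univ.filter fun k => a k ∈ t).card
        = ∑ z ∈ t, (Finset.univ.filter fun k => a k = z).card := by
      rw [Finset.card_eq_sum_card_fiberwise (f := a) (t := t) fun k hk => by simpa using hk]
      refine Finset.sum_congr rfl fun z hz => ?_
      rw [Finset.filter_filter]
      congr 1
      ext k
      simp only [Finset.mem_filter, Finset.mem_univ, true_and, and_iff_right_iff_imp]
      rintro rfl
      exact hz
    have h3 : (Finset.univ.filter fun k => a k ∈ t) = Finset.univ := by
      rw [← Finset.card_eq_iff_eq_univ, h2, ← Finset.card_univ, h1]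
      exact Finset.sum_congr rfl fun z hz => hcount z (htU z hz)
    intro k
    have := Finset.mem_univ k
    rw [← h3] at this
    exact htU _ (Finset.mem_filter.1 this).2
  refine isRearrangement_of_card_eq fun z => ?_
  by_cases hz : z ∈ U
  · exact hcount z hz
  · rw [Finset.filter_false_of_mem fun k _ (h : a k = z) => hz (h ▸ haU k),
      Finset.filter_false_of_mem fun k _ (h : b k = z) => hz (h ▸ hbU k)]

theorem HasZeros.zeroCount_eq {m : ℕ} {r : ℝ} {f : ℂ → ℂ} {a : Fin m → ℂ}
    (h : HasZeros (annulus r) f a) (ha : ∀ k, a k ∈ annulus r) : zeroCount r f = m := by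
  classical
  have hU := AnnulusDiskMap.isOpen_annulus r
  unfold zeroCount
  have h1 : ∑ᶠ z ∈ annulus r, analyticOrderNatAt f z =
      ∑ᶠ z, (Finset.univ.filter fun k => a k = z).card := by
    refine finsum_congr fun z => ?_
    by_cases hz : z ∈ annulus r
    · rw [finsum_eq_if, if_pos hz, h.analyticOrderNatAt_eq hU hz]
    · rw [finsum_eq_if, if_neg hz,
        Finset.filter_false_of_mem fun k _ (h : a k = z) => hz (h ▸ ha k), Finset.card_empty]
  rw [h1, finsum_eq_sum_of_support_subset (s := Finset.univ.image a)]
  · rw [← Finset.card_eq_sum_card_fiberwise fun k _ => by simp]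
    simp
  · intro z hz
    obtain ⟨k, hk⟩ := Finset.card_ne_zero.1 hz
    simp only [Finset.mem_filter] at hk
    simp only [Finset.coe_image, Finset.coe_univ, image_univ, mem_range]
    exact ⟨k, hk.2⟩

/-- A holomorphic function with finitely many zeros factors through them: the zeros are divided out
one at a time, each division lowering the total order by one. -/
theorem exists_hasZeros_of_sum_order_eq {U : Set ℂ} (hU : IsOpen U) (S : Finset ℂ)
    (hSU : ∀ z ∈ S, z ∈ U) (N : ℕ) : ∀ f : ℂ → ℂ, DifferentiableOn ℂ f U →
    (∀ z ∈ U, analyticOrderAt f z ≠ ⊤) → (∀ z ∈ U, f z = 0 → z ∈ S) →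
    ∑ z ∈ S, analyticOrderNatAt f z = N →
    ∃ a : Fin N → ℂ, (∀ k, a k ∈ U) ∧ HasZeros U f a := by
  induction N with
  | zero =>
    intro f hf hord hS hsum
    refine ⟨Fin.elim0, fun k => k.elim0, f, hf, fun z hz h0 => ?_, fun z _ => by simp⟩
    have hfa : AnalyticAt ℂ f z := hf.analyticAt (hU.mem_nhds hz)
    have h1 := Finset.sum_eq_zero_iff.1 hsum z (hS z hz h0)
    have h2 := Nat.cast_analyticOrderNatAt (hord z hz)
    rw [h1] at h2
    exact hfa.analyticOrderAt_eq_zero.1 (by simpa using h2.symm) h0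
  | succ N ih =>
    intro f hf hord hS hsum
    obtain ⟨a, haS, ha⟩ : ∃ a ∈ S, analyticOrderNatAt f a ≠ 0 := by
      by_contra! hcon
      rw [Finset.sum_eq_zero hcon] at hsum
      omega
    have hfa : f a = 0 := apply_eq_zero_of_analyticOrderNatAt_ne_zero ha
    set g := dslope f a with hg
    have hfg : ∀ z, f z = (z - a) * g z := fun z => by
      have := sub_smul_dslope f a z
      rw [hfa, sub_zero, smul_eq_mul] at this
      exact this.symm
    have hgd : DifferentiableOn ℂ g U :=
      (Complex.differentiableOn_dslope (hU.mem_nhds (hSU a haS))).2 hf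
    have hmul : ∀ z ∈ U, analyticOrderAt f z =
        (if a = z then 1 else 0) + analyticOrderAt g z := fun z hz => by
      have : f = (fun w => w - a) * g := funext hfg
      rw [this, analyticOrderAt_mul (by fun_prop) (hgd.analyticAt (hU.mem_nhds hz)),
        analyticOrderAt_sub_const]
    have hgord : ∀ z ∈ U, analyticOrderAt g z ≠ ⊤ := fun z hz h => by
      have := hmul z hz
      rw [h, add_top] at this
      exact hord z hz this
    have hnat : ∀ z ∈ U, analyticOrderNatAt f z =
        (if a = z then 1 else 0) + analyticOrderNatAt g z := fun z hz => by
      have h1 := hmul z hz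
      rw [← Nat.cast_analyticOrderNatAt (hord z hz), ← Nat.cast_analyticOrderNatAt (hgord z hz)]
        at h1
      split_ifs at h1 ⊢ <;> exact_mod_cast h1
    obtain ⟨b, hbU, G, hG, hG0, hgG⟩ := ih g hgd hgord
      (fun z hz h => hS z hz (by rw [hfg, h, mul_zero])) (by
        rw [Finset.sum_congr rfl fun z hz => hnat z (hSU z hz), Finset.sum_add_distrib,
          Finset.sum_ite_eq, if_pos haS] at hsum
        omega)
    refine ⟨Fin.cons a b, fun k => ?_, G, hG, hG0, fun z hz => ?_⟩
    · refine Fin.cases (hSU a haS) hbU k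
    · rw [hfg, hgG z hz, Fin.prod_univ_succ]
      simp [mul_assoc]

theorem exists_hasZeros_of_zeroCount_eq {r : ℝ} {e : ℕ} {f : ℂ → ℂ}
    (hf : DifferentiableOn ℂ f (annulus r)) (hfin : {z ∈ annulus r | f z = 0}.Finite)
    (hord : ∀ z ∈ annulus r, analyticOrderAt f z ≠ ⊤) (he : zeroCount r f = e) :
    ∃ a : Fin e → ℂ, (∀ k, a k ∈ annulus r) ∧ HasZeros (annulus r) f a := by
  refine exists_hasZeros_of_sum_order_eq (AnnulusDiskMap.isOpen_annulus r) hfin.toFinset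
    (fun z hz => ((Set.Finite.mem_toFinset hfin).1 hz).1) e f hf hord
    (fun z hz h => (Set.Finite.mem_toFinset hfin).2 ⟨hz, h⟩) ?_
  rw [← he, zeroCount, finsum_mem_eq_sum_of_inter_support_eq]
  ext z
  simp only [mem_inter_iff, Function.mem_support, Finite.coe_toFinset, mem_ofPred_eq]
  refine ⟨fun h => ⟨⟨h.1, ?_⟩, h.2⟩, fun h => ⟨h.1.1, h.2⟩⟩
  exact apply_eq_zero_of_analyticOrderNatAt_ne_zero h.2

/-! ### Coordinate slices and scaling -/

theorem IsRearrangement.norm_eq {m : ℕ} {E : Type*} [SeminormedAddCommGroup E] {a b : Fin m → E}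
    (h : IsRearrangement a b) : ‖a‖ = ‖b‖ := by
  obtain ⟨σ, rfl⟩ := h
  simp only [Pi.norm_def]
  congr 1
  refine le_antisymm (Finset.sup_le fun k _ => Finset.le_sup (f := fun k => ‖b k‖₊)
    (Finset.mem_univ (σ k))) (Finset.sup_le fun k _ => ?_)
  have := Finset.le_sup (f := fun k => ‖(b ∘ σ) k‖₊) (Finset.mem_univ (σ⁻¹ k))
  simpa using this

/-- Radial scaling identifies the tuples of a cone that have all entries in the unit disk with the
whole cone. -/
noncomputable def unitBallConeHomeomorph {m : ℕ} (Z : Set (Fin m → ℂ))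
    (hZ : ∀ t : ℝ, ∀ a ∈ Z, t • a ∈ Z) : {a : Fin m → ℂ // ‖a‖ < 1 ∧ a ∈ Z} ≃ₜ Z where
  toFun a := ⟨(1 - ‖a.1‖)⁻¹ • a.1, hZ _ _ a.2.2⟩
  invFun b := ⟨(1 + ‖b.1‖)⁻¹ • b.1, by
    have := norm_nonneg b.1
    rw [norm_smul, norm_inv, Real.norm_of_nonneg (by positivity), inv_mul_lt_one₀ (by positivity)]
    linarith, hZ _ _ b.2⟩
  left_inv := by
    rintro ⟨a, ha, hZ⟩
    ext1
    have h1 : 1 - ‖a‖ ≠ 0 := by linarith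
    have h2 : 0 ≤ 1 - ‖a‖ := by linarith
    simp only [norm_smul, norm_inv, Real.norm_of_nonneg h2, smul_smul]
    convert one_smul ℝ a using 2
    field_simp
    ring
  right_inv := by
    rintro ⟨b, hb⟩
    ext1
    have h1 : 1 + ‖b‖ ≠ 0 := by positivity
    have h2 : 0 ≤ 1 + ‖b‖ := by positivity
    simp only [norm_smul, norm_inv, Real.norm_of_nonneg h2, smul_smul]
    convert one_smul ℝ b using 2
    field_simp
    ring
  continuous_toFun := by
    refine Continuous.subtype_mk (Continuous.smul (Continuous.inv₀
      (continuous_const.sub continuous_subtype_val.norm) ?_) continuous_subtype_val) _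
    rintro ⟨a, ha, hZ⟩
    have : 0 < 1 - ‖a‖ := by linarith
    exact this.ne'
  continuous_invFun := by
    refine Continuous.subtype_mk (Continuous.smul (Continuous.inv₀
      (continuous_const.add continuous_subtype_val.norm) ?_) continuous_subtype_val) _
    intro b
    have : 0 < 1 + ‖b.1‖ := by linarith [norm_nonneg b.1]
    exact this.ne'

theorem unitBallConeHomeomorph_isRearrangement_iff {m : ℕ} (Z : Set (Fin m → ℂ))
    (hZ : ∀ t : ℝ, ∀ a ∈ Z, t • a ∈ Z) (a b : {a : Fin m → ℂ // ‖a‖ < 1 ∧ a ∈ Z}) :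
    IsRearrangement (unitBallConeHomeomorph Z hZ a).1 (unitBallConeHomeomorph Z hZ b).1 ↔
      IsRearrangement a.1 b.1 := by
  have key : ∀ (g : ℝ → ℝ) (u v : Fin m → ℂ), IsRearrangement u v →
      IsRearrangement (g ‖u‖ • u) (g ‖v‖ • v) := by
    intro g u v h
    rw [h.norm_eq]
    obtain ⟨σ, rfl⟩ := h
    exact ⟨σ, rfl⟩
  constructor
  · intro h
    have := key (fun t => (1 + t)⁻¹) _ _ h
    have e : ∀ c, (1 + ‖(unitBallConeHomeomorph Z hZ c).1‖)⁻¹ • (unitBallConeHomeomorph Z hZ c).1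
        = c.1 := fun c => congrArg Subtype.val ((unitBallConeHomeomorph Z hZ).left_inv c)
    rwa [e, e] at this
  · exact key (fun t => (1 - t)⁻¹) _ _

/-- The set of tuples whose `i`-th entry lies in `s`, as the product of `s` with the space of the
remaining entries. -/
noncomputable def coordinateSliceHomeomorph {m : ℕ} (i : Fin m) (s : Set ℂ) :
    {c : Fin m → ℂ | c i ∈ s} ≃ₜ s × ({j // j ≠ i} → ℂ) where
  toFun c := (⟨c.1 i, c.2⟩, fun j => c.1 j)
  invFun x := ⟨fun j => if h : j = i then x.1 else x.2 ⟨j, h⟩, by simp⟩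
  left_inv := by
    rintro ⟨c, hc⟩
    ext j
    by_cases h : j = i
    · subst h; simp
    · simp [h]
  right_inv := by
    rintro ⟨⟨w, hw⟩, x⟩
    refine Prod.ext (by simp) (funext fun j => ?_)
    simp [j.2]
  continuous_toFun := (Continuous.subtype_mk ((continuous_apply i).comp continuous_subtype_val)
    _).prodMk (continuous_pi fun j => (continuous_apply j.1).comp continuous_subtype_val)
  continuous_invFun := by
    refine Continuous.subtype_mk (continuous_pi fun j => ?_) _
    by_cases h : j = i
    · simp only [h, dif_pos]; fun_prop
    · simp only [h, dif_neg, not_false_eq_true]; fun_prop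

theorem finrank_complex_pi_ne {m : ℕ} (i : Fin m) :
    Module.finrank ℝ ({j // j ≠ i} → ℂ) = 2 * (m - 1) := by
  rw [Module.finrank_pi_fintype]
  simp [Fintype.card_subtype_compl, mul_comm]

theorem nonempty_zeroSlice_homeomorph {m : ℕ} (i : Fin m) :
    Nonempty ({c : Fin m → ℂ | c i ∈ ({0} : Set ℂ)} ≃ₜ EuclideanSpace ℝ (Fin (2 * m - 2))) := by
  have h : Module.finrank ℝ ({j // j ≠ i} → ℂ) =
      Module.finrank ℝ (EuclideanSpace ℝ (Fin (2 * m - 2))) := by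
    rw [finrank_complex_pi_ne, finrank_euclideanSpace_fin]
    omega
  exact ⟨((coordinateSliceHomeomorph i {0}).trans (Homeomorph.uniqueProd _ _)).trans
    (ContinuousLinearEquiv.ofFinrankEq h).toHomeomorph⟩

/-! ### Blaschke products -/

theorem exists_tendsto_of_mem_isCompact {S Y : Type*} [TopologicalSpace Y] {K : Set Y}
    (hK : IsCompact K) (𝒰 : Ultrafilter S) (g : S → Y) (hg : ∀ s, g s ∈ K) :
    ∃ y ∈ K, Tendsto g 𝒰 (𝓝 y) := by
  obtain ⟨y, hy, h⟩ := hK.ultrafilter_le_nhds (𝒰.map g)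
    (le_principal_iff.2 (Filter.mem_map.2 (Filter.univ_mem' hg)))
  exact ⟨y, hy, h⟩

theorem one_sub_conj_mul_ne_zero {a z : ℂ} (ha : ‖a‖ ≤ 1) (hz : ‖z‖ < 1) :
    1 - conj a * z ≠ 0 := by
  intro h
  have h1 : conj a * z = 1 := (sub_eq_zero.1 h).symm
  have h2 : ‖a‖ * ‖z‖ = 1 := by rw [← RCLike.norm_conj a, ← norm_mul, h1, norm_one]
  nlinarith [norm_nonneg a, norm_nonneg z]

theorem norm_blaschkeFactor_lt_one {a z : ℂ} (ha : ‖a‖ < 1) (hz : ‖z‖ < 1) :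
    ‖(z - a) / (1 - conj a * z)‖ < 1 := by
  have h0 := norm_pos_iff.2 (one_sub_conj_mul_ne_zero ha.le hz)
  rw [norm_div, div_lt_one h0]
  refine lt_of_pow_lt_pow_left₀ 2 (norm_nonneg _) ?_
  have h1 : ‖1 - conj a * z‖ ^ 2 - ‖z - a‖ ^ 2 = (1 - ‖a‖ ^ 2) * (1 - ‖z‖ ^ 2) := by
    simp only [← Complex.normSq_eq_norm_sq, Complex.normSq_apply]
    simp
    ring
  have h2 : 0 < (1 - ‖a‖ ^ 2) * (1 - ‖z‖ ^ 2) := by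
    refine mul_pos ?_ ?_ <;> nlinarith [norm_nonneg a, norm_nonneg z]
  linarith

theorem norm_blaschkeConst {D : ℕ} (a : Fin D → ℂ) (ha : ∀ k, ‖a k‖ < 1) :
    ‖∏ k, (1 - conj (a k)) / (1 - a k)‖ = 1 := by
  rw [norm_prod]
  refine Finset.prod_eq_one fun k _ => ?_
  have h : (1 : ℂ) - conj (a k) = conj (1 - a k) := by simp
  have h' : 1 - a k ≠ 0 := fun h0 => by
    have := ha k
    rw [← sub_eq_zero.1 h0, norm_one] at this
    exact lt_irrefl _ this
  rw [norm_div, h, RCLike.norm_conj, div_self (norm_ne_zero_iff.2 h')]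

theorem norm_blaschke_lt_one {D : ℕ} (hD : 0 < D) (a : Fin D → 𝔻) (z : 𝔻) :
    ‖blaschke a z‖ < 1 := by
  unfold blaschke
  rw [norm_mul, norm_blaschkeConst _ fun k => (a k).norm_lt_one, one_mul, norm_prod]
  have h : ∀ k, ‖((z : ℂ) - a k) / (1 - conj (a k : ℂ) * z)‖ < 1 := fun k =>
    norm_blaschkeFactor_lt_one (a k).norm_lt_one z.norm_lt_one
  rw [← Finset.mul_prod_erase _ _ (Finset.mem_univ (⟨0, hD⟩ : Fin D))]
  exact mul_lt_one_of_nonneg_of_lt_one_left (norm_nonneg _) (h _)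
    (Finset.prod_le_one (fun _ _ => norm_nonneg _) fun k _ => (h k).le)

/-- A finite product of Blaschke factors has exactly the given zeros. The parameters may lie on the
unit circle, where the factors degenerate to constants. -/
theorem hasZeros_blaschkeProduct {D : ℕ} {f : ℂ → ℂ} {a : Fin D → ℂ} {c : ℂ} (hc : c ≠ 0)
    (ha : ∀ k, ‖a k‖ ≤ 1)
    (hf : ∀ z ∈ Metric.ball (0 : ℂ) 1, f z = c * ∏ k, (z - a k) / (1 - conj (a k) * z)) :
    HasZeros (Metric.ball 0 1) f a := by
  have h0 : ∀ z ∈ Metric.ball (0 : ℂ) 1, ∀ k, 1 - conj (a k) * z ≠ 0 := fun z hz k =>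
    one_sub_conj_mul_ne_zero (ha k) (by simpa using hz)
  refine ⟨fun z => c * (∏ k, (1 - conj (a k) * z))⁻¹, ?_, fun z hz => ?_, fun z hz => ?_⟩
  · refine DifferentiableOn.const_mul (DifferentiableOn.inv (by fun_prop) fun z hz => ?_) _
    exact Finset.prod_ne_zero_iff.2 fun k _ => h0 z hz k
  · exact mul_ne_zero hc (inv_ne_zero (Finset.prod_ne_zero_iff.2 fun k _ => h0 z hz k))
  · rw [hf z hz, Finset.prod_div_distrib, div_eq_mul_inv]
    ring

theorem blaschke_congr {D : ℕ} {a b : Fin D → 𝔻}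
    (h : IsRearrangement (fun k => (a k : ℂ)) fun k => (b k : ℂ)) (z : ℂ) :
    blaschke a z = blaschke b z := by
  unfold blaschke
  rw [h.prod_eq fun w => (1 - conj w) / (1 - w), h.prod_eq fun w => (z - w) / (1 - conj w * z)]

theorem hasZeros_blaschke {D : ℕ} (a : Fin D → 𝔻) :
    HasZeros (Metric.ball 0 1) (blaschke a) fun k => (a k : ℂ) := by
  refine hasZeros_blaschkeProduct (norm_ne_zero_iff.1 ?_) (fun k => (a k).norm_lt_one.le)
    fun z _ => rfl
  rw [norm_blaschkeConst _ fun k => (a k).norm_lt_one]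
  exact one_ne_zero

/-- The Blaschke products of degree `D`, normalized by `β(1) = 1`, whose tuple of zeros lies in
`Z`. -/
def blaschkeProducts (D : ℕ) (Z : Set (Fin D → ℂ)) : Set C(𝔻, 𝔻) :=
  {β | ∃ a : Fin D → 𝔻, (∀ z : 𝔻, (β z : ℂ) = blaschke a z) ∧ (fun k => (a k : ℂ)) ∈ Z}

/-- A tuple of complex numbers of sup norm less than `1`, as a tuple of points of the disk. -/
def toDiscTuple {D : ℕ} (a : Fin D → ℂ) (ha : ‖a‖ < 1) (k : Fin D) : 𝔻 :=
  UnitDisc.mk (a k) ((norm_le_pi_norm a k).trans_lt ha)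

/-- The Blaschke product with given zeros. -/
noncomputable def blaschkeOfZeros {D : ℕ} (hD : 0 < D) (Z : Set (Fin D → ℂ))
    (a : {a : Fin D → ℂ // ‖a‖ < 1 ∧ a ∈ Z}) : blaschkeProducts D Z :=
  ⟨⟨fun z => UnitDisc.mk (blaschke (toDiscTuple a.1 a.2.1) z) (norm_blaschke_lt_one hD _ z), by
    refine UnitDisc.isEmbedding_coe.continuous_iff.2 ?_
    change Continuous fun z : 𝔻 => blaschke (toDiscTuple a.1 a.2.1) z
    unfold blaschke
    refine continuous_const.mul (continuous_finsetProd _ fun k _ => ?_)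
    refine Continuous.div (by fun_prop) (by fun_prop) fun z => ?_
    exact one_sub_conj_mul_ne_zero (UnitDisc.norm_lt_one _).le z.norm_lt_one⟩,
    toDiscTuple a.1 a.2.1, fun _ => rfl, a.2.2⟩

theorem continuous_blaschkeOfZeros {D : ℕ} (hD : 0 < D) (Z : Set (Fin D → ℂ)) :
    Continuous (blaschkeOfZeros hD Z) := by
  refine Continuous.subtype_mk (ContinuousMap.continuous_of_continuous_uncurry _ ?_) _
  refine UnitDisc.isEmbedding_coe.continuous_iff.2 ?_
  change Continuous fun x : {a : Fin D → ℂ // ‖a‖ < 1 ∧ a ∈ Z} × 𝔻 =>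
    (∏ k, (1 - conj (x.1.1 k)) / (1 - x.1.1 k)) *
      ∏ k, ((x.2 : ℂ) - x.1.1 k) / (1 - conj (x.1.1 k) * (x.2 : ℂ))
  have hlt : ∀ (x : {a : Fin D → ℂ // ‖a‖ < 1 ∧ a ∈ Z} × 𝔻) k, ‖x.1.1 k‖ < 1 := fun x k =>
    (norm_le_pi_norm _ k).trans_lt x.1.2.1
  have hcont : ∀ k, Continuous fun x : {a : Fin D → ℂ // ‖a‖ < 1 ∧ a ∈ Z} × 𝔻 => x.1.1 k :=
    fun k => (continuous_apply k).comp (continuous_subtype_val.comp continuous_fst)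
  have hconj := fun k => continuous_conj.comp (hcont k)
  have hz : Continuous fun x : {a : Fin D → ℂ // ‖a‖ < 1 ∧ a ∈ Z} × 𝔻 => (x.2 : ℂ) :=
    UnitDisc.continuous_coe.comp continuous_snd
  refine Continuous.mul (continuous_finsetProd _ fun k _ => ?_)
    (continuous_finsetProd _ fun k _ => ?_)
  · refine Continuous.div (continuous_const.sub (hconj k)) (continuous_const.sub (hcont k))
      fun x h0 => ?_
    have := hlt x k
    rw [← sub_eq_zero.1 h0, norm_one] at this
    exact lt_irrefl _ this
  · refine Continuous.div (hz.sub (hcont k)) (continuous_const.sub ((hconj k).mul hz))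
      fun x => ?_
    exact one_sub_conj_mul_ne_zero (hlt x k).le x.2.norm_lt_one

theorem surjective_blaschkeOfZeros {D : ℕ} (hD : 0 < D) (Z : Set (Fin D → ℂ)) :
    Function.Surjective (blaschkeOfZeros hD Z) := by
  rintro ⟨β, a, ha, haZ⟩
  have hlt : ‖fun k => (a k : ℂ)‖ < 1 :=
    (pi_norm_lt_iff one_pos).2 fun k => (a k).norm_lt_one
  refine ⟨⟨fun k => (a k : ℂ), hlt, haZ⟩, Subtype.ext (ContinuousMap.ext fun z => ?_)⟩
  exact UnitDisc.coe_injective (ha z).symm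

theorem blaschkeOfZeros_eq_iff {D : ℕ} (hD : 0 < D) (Z : Set (Fin D → ℂ))
    (a b : {a : Fin D → ℂ // ‖a‖ < 1 ∧ a ∈ Z}) :
    blaschkeOfZeros hD Z a = blaschkeOfZeros hD Z b ↔ IsRearrangement a.1 b.1 := by
  constructor
  · intro h
    have h1 : ∀ z ∈ Metric.ball (0 : ℂ) 1,
        blaschke (toDiscTuple a.1 a.2.1) z = blaschke (toDiscTuple b.1 b.2.1) z := fun z hz =>
      congrArg (fun β : blaschkeProducts D Z => (β.1 (UnitDisc.mk z (by simpa using hz)) : ℂ)) h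
    obtain ⟨G, hG, hG0, hfG⟩ := hasZeros_blaschke (toDiscTuple b.1 b.2.1)
    exact (hasZeros_blaschke (toDiscTuple a.1 a.2.1)).isRearrangement
      ⟨G, hG, hG0, fun z hz => (h1 z hz).trans (hfG z hz)⟩ Metric.isOpen_ball
      fun k => (toDiscTuple b.1 b.2.1 k).2
  · intro h
    refine Subtype.ext (ContinuousMap.ext fun z => UnitDisc.coe_injective ?_)
    exact blaschke_congr (a := toDiscTuple a.1 a.2.1) (b := toDiscTuple b.1 b.2.1) h z

/-- If Blaschke products of degree `D` converge to one of the same degree, then every limit point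
of their zeros lies in the open disk, since the degree of a limit drops by the number of zeros that
escape to the unit circle. -/
theorem isProperMap_blaschkeOfZeros {D : ℕ} (hD : 0 < D) (Z : Set (Fin D → ℂ))
    (hZ : ∀ a b, IsRearrangement a b → b ∈ Z → a ∈ Z) : IsProperMap (blaschkeOfZeros hD Z) := by
  refine isProperMap_iff_ultrafilter.2 ⟨continuous_blaschkeOfZeros hD Z, fun 𝒰 β hβ => ?_⟩
  obtain ⟨b, rfl⟩ := surjective_blaschkeOfZeros hD Z β
  obtain ⟨a, haK, ha⟩ := exists_tendsto_of_mem_isCompact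
    (isCompact_closedBall (0 : Fin D → ℂ) 1) 𝒰 Subtype.val fun s => by simpa using s.2.1.le
  have hak : ∀ k, ‖a k‖ ≤ 1 := fun k => (norm_le_pi_norm a k).trans (by simpa using haK)
  have hlt : ∀ (s : {a : Fin D → ℂ // ‖a‖ < 1 ∧ a ∈ Z}) k, ‖s.1 k‖ < 1 := fun s k =>
    (norm_le_pi_norm _ k).trans_lt s.2.1
  obtain ⟨c, hcK, hc⟩ := exists_tendsto_of_mem_isCompact
    (isCompact_sphere (0 : ℂ) 1) 𝒰 (fun s => ∏ k, (1 - conj (s.1 k)) / (1 - s.1 k)) fun s => by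
      simpa using norm_blaschkeConst s.1 (hlt s)
  have hc0 : c ≠ 0 := ne_zero_of_mem_unit_sphere ⟨c, hcK⟩
  have heq : ∀ z ∈ Metric.ball (0 : ℂ) 1, blaschke (toDiscTuple b.1 b.2.1) z =
      c * ∏ k, (z - a k) / (1 - conj (a k) * z) := by
    intro z hz
    have hz' : ‖z‖ < 1 := by simpa using hz
    have h1 : Tendsto (fun s => ((blaschkeOfZeros hD Z s).1 (UnitDisc.mk z hz') : ℂ)) 𝒰
        (𝓝 ((blaschkeOfZeros hD Z b).1 (UnitDisc.mk z hz'))) := by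
      have hcont : Continuous fun β : blaschkeProducts D Z => (β.1 (UnitDisc.mk z hz') : ℂ) :=
        UnitDisc.continuous_coe.comp
          ((continuous_eval_const (UnitDisc.mk z hz')).comp continuous_subtype_val)
      exact (hcont.tendsto _).comp hβ
    refine tendsto_nhds_unique h1 ?_
    refine hc.mul (tendsto_finsetProd _ fun k _ => ?_)
    have hk : Tendsto (fun s : {a : Fin D → ℂ // ‖a‖ < 1 ∧ a ∈ Z} => s.1 k) 𝒰 (𝓝 (a k)) :=
      ((continuous_apply k).tendsto a).comp ha
    exact (tendsto_const_nhds.sub hk).div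
      (tendsto_const_nhds.sub (((continuous_conj.tendsto _).comp hk).mul tendsto_const_nhds))
      (one_sub_conj_mul_ne_zero (hak k) hz')
  have hre : IsRearrangement a b.1 := (hasZeros_blaschkeProduct hc0 hak heq).isRearrangement
    (hasZeros_blaschke _) Metric.isOpen_ball fun k => (toDiscTuple b.1 b.2.1 k).2
  refine ⟨⟨a, hre.norm_eq ▸ b.2.1, hZ _ _ hre b.2.2⟩, ?_, ?_⟩
  · exact (blaschkeOfZeros_eq_iff hD Z _ _).2 hre
  · exact (tendsto_subtype_rng (f := id)).2 ha

theorem nonempty_blaschkeProducts_homeomorph {D : ℕ} (hD : 0 < D) (W : Set (Fin D → ℂ))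
    (hW : ∀ t : ℝ, ∀ a : Fin D → ℂ, coeffsOfRoots a ∈ W → coeffsOfRoots (t • a) ∈ W) :
    Nonempty (blaschkeProducts D (coeffsOfRoots ⁻¹' W) ≃ₜ W) := by
  have hZ : ∀ a b, IsRearrangement a b → b ∈ coeffsOfRoots ⁻¹' W → a ∈ coeffsOfRoots ⁻¹' W := by
    intro a b h hb
    rwa [mem_preimage, coeffsOfRoots_eq_iff.2 h]
  have hp := isProperMap_blaschkeOfZeros hD _ hZ
  have hq := isProperMap_coeffsOfRoots.restrictPreimage W
  refine nonempty_homeomorph_of_isQuotientMap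
    (hp.isClosedMap.isQuotientMap hp.continuous (surjective_blaschkeOfZeros hD _))
    (hq.isClosedMap.isQuotientMap hq.continuous
      (W.restrictPreimage_surjective surjective_coeffsOfRoots))
    (unitBallConeHomeomorph _ hW) fun a b => ?_
  rw [blaschkeOfZeros_eq_iff, ← unitBallConeHomeomorph_isRearrangement_iff _ hW,
    ← coeffsOfRoots_eq_iff, Subtype.ext_iff]
  rfl

theorem nonempty_blaschkeFC_homeomorph {D : ℕ} (hD : 0 < D) :
    Nonempty (BlaschkeFC D ≃ₜ EuclideanSpace ℝ (Fin (2 * D - 2))) := by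
  have h : BlaschkeFC D =
      blaschkeProducts D (coeffsOfRoots ⁻¹' {c | c ⟨0, hD⟩ ∈ ({0} : Set ℂ)}) := by
    ext β
    constructor
    · rintro ⟨⟨a, ha⟩, h0⟩
      refine ⟨a, ha, ?_⟩
      have h1 : blaschke a 0 = 0 := by rw [← UnitDisc.coe_zero, ← ha, h0]
      have h2 := norm_blaschkeConst (fun k => (a k : ℂ)) fun k => (a k).norm_lt_one
      rw [mem_preimage, mem_ofPred_eq, coeffsOfRoots_zero, mem_singleton_iff]
      rcases mul_eq_zero.1 h1 with h3 | h3
      · rw [h3] at h2; simp at h2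
      · simpa using h3
    · rintro ⟨a, ha, h1⟩
      refine ⟨⟨a, ha⟩, UnitDisc.coe_injective ?_⟩
      rw [mem_preimage, mem_ofPred_eq, coeffsOfRoots_zero, mem_singleton_iff] at h1
      rw [ha, UnitDisc.coe_zero, blaschke]
      simp [h1]
  obtain ⟨e⟩ := nonempty_zeroSlice_homeomorph (⟨0, hD⟩ : Fin D)
  rw [h]
  refine ⟨(Classical.choice (nonempty_blaschkeProducts_homeomorph hD _ ?_)).trans e⟩
  intro t a ha
  rw [mem_ofPred_eq, coeffsOfRoots_zero, mem_singleton_iff] at ha ⊢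
  obtain ⟨k, -, hk⟩ := Finset.prod_eq_zero_iff.1 ha
  refine Finset.prod_eq_zero (Finset.mem_univ k) ?_
  rw [Pi.smul_apply, ← smul_neg, hk, smul_zero]

/-- By the Schwarz lemma, the automorphisms of the disk fixing `0` are rotations. -/
theorem isConformalBarycenter_zero_iff {D : ℕ} (p : Fin D → 𝔻) :
    IsConformalBarycenter 0 p ↔ ∑ k, (p k : ℂ) = 0 := by
  constructor
  · rintro ⟨φ, ψ, hφ, hψ, hφm, hψm, hinv, h0, hsum⟩
    rw [UnitDisc.coe_zero] at h0
    have hψ0 : ψ 0 = 0 := by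
      have := hinv.1 (Metric.mem_ball_self one_pos)
      rwa [h0] at this
    set z₀ : ℂ := 1 / 2 with hz₀
    have hz₀n : ‖z₀‖ = 1 / 2 := by simp [hz₀]
    have hz₀b : z₀ ∈ Metric.ball (0 : ℂ) 1 := by
      rw [mem_ball_zero_iff, hz₀n]; norm_num
    have hn : ‖φ z₀‖ = ‖z₀‖ := by
      refine le_antisymm (Complex.norm_le_norm_of_mapsTo_ball hφ
        (hφm.mono_right Metric.ball_subset_closedBall) h0 (by simpa using hz₀b)) ?_
      have := Complex.norm_le_norm_of_mapsTo_ball hψ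
        (hψm.mono_right Metric.ball_subset_closedBall) hψ0 (by simpa using hφm hz₀b)
      rwa [hinv.1 hz₀b] at this
    have hds : ‖dslope φ 0 z₀‖ = 1 / 1 := by
      rw [dslope_of_ne _ (by simp [hz₀]), slope_def_field, h0, sub_zero, sub_zero, norm_div, hn,
        hz₀n]
      norm_num
    obtain ⟨C, hC, hφC⟩ := Complex.affine_of_mapsTo_ball_of_exists_norm_dslope_eq_div' hφ
      (by rw [h0]; exact hφm.mono_right Metric.ball_subset_closedBall) ⟨z₀, hz₀b, hds⟩
    have hC0 : C ≠ 0 := by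
      rintro rfl
      simp at hC
    have h1 : ∑ k, φ (p k) = (∑ k, (p k : ℂ)) * C := by
      rw [Finset.sum_mul]
      refine Finset.sum_congr rfl fun k _ => ?_
      refine (hφC (p k).2).trans ?_
      simp only [h0, zero_add, sub_zero, smul_eq_mul]
      rfl
    rw [h1] at hsum
    exact (mul_eq_zero.1 hsum).resolve_right hC0
  · intro h
    exact ⟨id, id, differentiableOn_id, differentiableOn_id, mapsTo_id _, mapsTo_id _,
      ⟨fun _ _ => rfl, fun _ _ => rfl⟩, rfl, h⟩

theorem nonempty_blaschkeZC_homeomorph {D : ℕ} (hD : 0 < D) :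
    Nonempty (BlaschkeZC D ≃ₜ EuclideanSpace ℝ (Fin (2 * D - 2))) := by
  have hD' : D - 1 < D := by omega
  have h : BlaschkeZC D =
      blaschkeProducts D (coeffsOfRoots ⁻¹' {c | c ⟨D - 1, hD'⟩ ∈ ({0} : Set ℂ)}) := by
    ext β
    refine exists_congr fun a => and_congr_right fun _ => ?_
    rw [isConformalBarycenter_zero_iff, mem_preimage, mem_ofPred_eq, coeffsOfRoots_last hD,
      mem_singleton_iff, neg_eq_zero]
  obtain ⟨e⟩ := nonempty_zeroSlice_homeomorph (⟨D - 1, hD'⟩ : Fin D)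
  rw [h]
  refine ⟨(Classical.choice (nonempty_blaschkeProducts_homeomorph hD _ ?_)).trans e⟩
  intro t a ha
  rw [mem_ofPred_eq, coeffsOfRoots_last hD, mem_singleton_iff, neg_eq_zero] at ha ⊢
  simp only [Pi.smul_apply]
  rw [← Finset.smul_sum, ha, smul_zero]

/-! ### The product `∏ (1 - qⁿ w)` -/

/-- The logarithm of the infinite product `∏ (1 - qⁿ w)`, `n ≥ 0`, for `|q| < 1` and `‖w‖ < 1`. -/
noncomputable def logQProduct (q : ℝ) (w : ℂ) : ℂ := ∑' n : ℕ, Complex.log (1 - (q : ℂ) ^ n * w)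

theorem norm_pow_mul_lt_one {q : ℝ} {w : ℂ} (hq : |q| < 1) (hw : ‖w‖ < 1) (n : ℕ) :
    ‖(q : ℂ) ^ n * w‖ < 1 := by
  rw [norm_mul, norm_pow, Complex.norm_real, Real.norm_eq_abs]
  exact (mul_le_of_le_one_left (norm_nonneg w) (pow_le_one₀ (abs_nonneg q) hq.le)).trans_lt hw

theorem one_sub_mem_slitPlane {w : ℂ} (hw : ‖w‖ < 1) : 1 - w ∈ slitPlane := by
  rw [sub_eq_add_neg]
  exact mem_slitPlane_of_norm_lt_one (by rwa [norm_neg])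

theorem norm_log_one_sub_pow_mul_le {q q₀ ρ : ℝ} {w : ℂ} (hq : |q| ≤ q₀) (hq₀ : q₀ < 1)
    (hw : ‖w‖ ≤ ρ) (hρ : ρ < 1) (n : ℕ) :
    ‖Complex.log (1 - (q : ℂ) ^ n * w)‖ ≤ q₀ ^ n * ((1 - ρ)⁻¹ / 2 + 1) := by
  set x := (q : ℂ) ^ n * w with hx
  have hx1 : ‖x‖ < 1 := norm_pow_mul_lt_one (hq.trans_lt hq₀) (hw.trans_lt hρ) n
  have hxn : ‖x‖ = |q| ^ n * ‖w‖ := by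
    rw [hx, norm_mul, norm_pow, Complex.norm_real, Real.norm_eq_abs]
  have hq0 := abs_nonneg q
  have hxρ : ‖x‖ ≤ ρ := by
    rw [hxn]
    exact (mul_le_of_le_one_left (norm_nonneg w)
      (pow_le_one₀ hq0 (hq.trans hq₀.le))).trans hw
  have hxq : ‖x‖ ≤ q₀ ^ n := by
    rw [hxn]
    exact (mul_le_of_le_one_right (by positivity) (hw.trans hρ.le)).trans
      (pow_le_pow_left₀ hq0 hq n)
  have h1 := Complex.norm_log_one_add_le (z := -x) (by rwa [norm_neg])
  rw [← sub_eq_add_neg, norm_neg] at h1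
  have h2 : (1 - ‖x‖)⁻¹ ≤ (1 - ρ)⁻¹ := inv_anti₀ (by linarith) (by linarith)
  have h3 : 0 ≤ (1 - ‖x‖)⁻¹ := inv_nonneg.2 (by linarith)
  calc ‖Complex.log (1 - x)‖ ≤ ‖x‖ ^ 2 * (1 - ‖x‖)⁻¹ / 2 + ‖x‖ := h1
    _ = ‖x‖ * (‖x‖ * (1 - ‖x‖)⁻¹ / 2 + 1) := by ring
    _ ≤ q₀ ^ n * ((1 - ρ)⁻¹ / 2 + 1) := by
      have h4 : 0 ≤ ‖x‖ * (1 - ‖x‖)⁻¹ := mul_nonneg (norm_nonneg x) h3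
      refine mul_le_mul hxq ?_ (by linarith) ((norm_nonneg x).trans hxq)
      gcongr
      exact (mul_le_of_le_one_left h3 hx1.le).trans h2

theorem summable_geometric_mul {q₀ : ℝ} (h0 : 0 ≤ q₀) (hq₀ : q₀ < 1) (c : ℝ) :
    Summable fun n : ℕ => q₀ ^ n * c :=
  (summable_geometric_of_lt_one h0 hq₀).mul_right c

theorem continuousAt_logQProduct {q : ℝ} {w : ℂ} (hq : |q| < 1) (hw : ‖w‖ < 1) :
    ContinuousAt (fun p : ℝ × ℂ => logQProduct p.1 p.2) (q, w) := by
  obtain ⟨q₀, hqq, hq₀⟩ := exists_between hq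
  obtain ⟨ρ, hwρ, hρ⟩ := exists_between hw
  have hs : {p : ℝ × ℂ | |p.1| < q₀ ∧ ‖p.2‖ < ρ} ∈ 𝓝 (q, w) :=
    ((isOpen_lt continuous_fst.abs continuous_const).inter
      (isOpen_lt continuous_snd.norm continuous_const)).mem_nhds ⟨hqq, hwρ⟩
  refine ContinuousOn.continuousAt ?_ hs
  refine continuousOn_tsum (fun n => ?_)
    (summable_geometric_mul ((abs_nonneg q).trans hqq.le) hq₀ ((1 - ρ)⁻¹ / 2 + 1))
    fun n p hp => norm_log_one_sub_pow_mul_le hp.1.le hq₀ hp.2.le hρ n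
  refine ContinuousOn.clog (by fun_prop) fun p hp => one_sub_mem_slitPlane ?_
  exact norm_pow_mul_lt_one (hp.1.trans hq₀) (hp.2.trans hρ) n

theorem differentiableAt_logQProduct {q : ℝ} {w : ℂ} (hq : |q| < 1) (hw : ‖w‖ < 1) :
    DifferentiableAt ℂ (logQProduct q) w := by
  obtain ⟨ρ, hwρ, hρ⟩ := exists_between hw
  have hs : Metric.ball (0 : ℂ) ρ ∈ 𝓝 w := Metric.isOpen_ball.mem_nhds (by simpa using hwρ)
  refine DifferentiableOn.differentiableAt (s := Metric.ball 0 ρ) ?_ hs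
  refine differentiableOn_tsum_of_summable_norm
    (summable_geometric_mul (abs_nonneg q) hq ((1 - ρ)⁻¹ / 2 + 1)) (fun n => ?_)
    Metric.isOpen_ball fun n p hp => norm_log_one_sub_pow_mul_le le_rfl hq
      (by simpa using (mem_ball_zero_iff.1 hp).le) hρ n
  refine DifferentiableOn.clog (by fun_prop) fun p hp => one_sub_mem_slitPlane ?_
  exact norm_pow_mul_lt_one hq ((mem_ball_zero_iff.1 hp).trans hρ) n

/-- The functional equation `E w = (1 - w) E (q w)` of `E w = ∏ (1 - qⁿ w)`. -/
theorem exp_logQProduct {q : ℝ} {w : ℂ} (hq : |q| < 1) (hw : ‖w‖ < 1) :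
    exp (logQProduct q w) = (1 - w) * exp (logQProduct q (q * w)) := by
  have hsum : Summable fun n : ℕ => Complex.log (1 - (q : ℂ) ^ n * w) :=
    Summable.of_norm_bounded (summable_geometric_mul (abs_nonneg q) hq _)
      fun n => norm_log_one_sub_pow_mul_le le_rfl hq le_rfl hw n
  have h : logQProduct q w = Complex.log (1 - w) + logQProduct q (q * w) := by
    unfold logQProduct
    rw [hsum.tsum_eq_zero_add]
    simp only [pow_zero, one_mul, pow_succ, mul_assoc]
  rw [h, exp_add, exp_log (slitPlane_ne_zero (one_sub_mem_slitPlane hw))]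

theorem norm_exp_logQProduct_conj {q : ℝ} {w : ℂ} (hq : |q| < 1) (hw : ‖w‖ < 1) :
    ‖exp (logQProduct q (conj w))‖ = ‖exp (logQProduct q w)‖ := by
  have h : logQProduct q (conj w) = conj (logQProduct q w) := by
    unfold logQProduct
    rw [Complex.conj_tsum]
    refine tsum_congr fun n => ?_
    rw [← log_conj _ (slitPlane_arg_ne_pi
      (one_sub_mem_slitPlane (norm_pow_mul_lt_one hq hw n)))]
    simp
  rw [h, norm_exp, norm_exp, conj_re]

/-! ### Annular analogues of Blaschke factors -/

/-- The points where the infinite products of `annulusFactor r a z` converge. -/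
structure IsRegularTriple (r : ℝ) (a z : ℂ) : Prop where
  r_pos : 0 < r
  r_lt_one : r < 1
  sq_mul_norm_lt : r ^ 2 * ‖z‖ < ‖a‖
  sq_mul_norm_lt' : r ^ 2 * ‖a‖ < ‖z‖
  mul_lt_one : ‖a‖ * ‖z‖ < 1
  lt_mul : r ^ 2 < ‖a‖ * ‖z‖

/-- The logarithm of the zero-free part of `annulusFactor`. -/
noncomputable def logAnnulusFactor (r : ℝ) (a z : ℂ) : ℂ :=
  logQProduct (r ^ 2) (((r ^ 2 : ℝ) : ℂ) * (z / a)) +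
    logQProduct (r ^ 2) (((r ^ 2 : ℝ) : ℂ) * (a / z)) -
    logQProduct (r ^ 2) (conj a * z) - logQProduct (r ^ 2) (((r ^ 2 : ℝ) : ℂ) / (conj a * z))

/-- The quotient `P (z / a) / P (ā z)` of values of the theta function
`P w = ∏ (1 - qⁿ w) ∏ (1 - qⁿ⁺¹ / w)`, `q = r²`. It has a single zero in `𝔸_r`, at `a`, and constant
modulus on each of the two boundary circles. -/
noncomputable def annulusFactor (r : ℝ) (a z : ℂ) : ℂ :=
  (1 - z / a) * exp (logAnnulusFactor r a z)

namespace IsRegularTriple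

variable {r : ℝ} {a z : ℂ}

theorem abs_sq_lt_one (h : IsRegularTriple r a z) : |r ^ 2| < 1 := by
  rw [abs_of_nonneg (by positivity)]
  exact pow_lt_one₀ h.r_pos.le h.r_lt_one two_ne_zero

theorem sq_pos (h : IsRegularTriple r a z) : 0 < r ^ 2 := pow_pos h.r_pos 2

theorem left_ne_zero (h : IsRegularTriple r a z) : a ≠ 0 := by
  rintro rfl
  have := h.lt_mul
  have := h.sq_pos
  simp at *
  linarith

theorem right_ne_zero (h : IsRegularTriple r a z) : z ≠ 0 := by
  rintro rfl
  have := h.lt_mul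
  have := h.sq_pos
  simp at *
  linarith

theorem norm_sq_mul_div_lt_one (h : IsRegularTriple r a z) :
    ‖((r ^ 2 : ℝ) : ℂ) * (z / a)‖ < 1 := by
  rw [norm_mul, norm_div, Complex.norm_real, Real.norm_of_nonneg h.sq_pos.le, ← mul_div_assoc,
    div_lt_one (norm_pos_iff.2 h.left_ne_zero)]
  exact h.sq_mul_norm_lt

theorem norm_sq_mul_div_lt_one' (h : IsRegularTriple r a z) :
    ‖((r ^ 2 : ℝ) : ℂ) * (a / z)‖ < 1 := by
  rw [norm_mul, norm_div, Complex.norm_real, Real.norm_of_nonneg h.sq_pos.le, ← mul_div_assoc,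
    div_lt_one (norm_pos_iff.2 h.right_ne_zero)]
  exact h.sq_mul_norm_lt'

theorem norm_conj_mul_lt_one (h : IsRegularTriple r a z) : ‖conj a * z‖ < 1 := by
  rw [norm_mul, RCLike.norm_conj]
  exact h.mul_lt_one

theorem norm_sq_div_lt_one (h : IsRegularTriple r a z) :
    ‖((r ^ 2 : ℝ) : ℂ) / (conj a * z)‖ < 1 := by
  rw [norm_div, norm_mul, RCLike.norm_conj, Complex.norm_real, Real.norm_of_nonneg h.sq_pos.le,
    div_lt_one (h.sq_pos.trans h.lt_mul)]
  exact h.lt_mul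

theorem continuousAt_annulusFactor (h : IsRegularTriple r a z) :
    ContinuousAt (fun p : ℝ × ℂ × ℂ => annulusFactor p.1 p.2.1 p.2.2) (r, a, z) := by
  have ha := h.left_ne_zero
  have hz := h.right_ne_zero
  have hr : ContinuousAt (fun p : ℝ × ℂ × ℂ => p.1 ^ 2) (r, a, z) := by fun_prop
  have hrc : ContinuousAt (fun p : ℝ × ℂ × ℂ => ((p.1 ^ 2 : ℝ) : ℂ)) (r, a, z) :=
    continuous_ofReal.continuousAt.comp hr
  have hpa : ContinuousAt (fun p : ℝ × ℂ × ℂ => p.2.1) (r, a, z) := by fun_prop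
  have hpz : ContinuousAt (fun p : ℝ × ℂ × ℂ => p.2.2) (r, a, z) := by fun_prop
  have hpc : ContinuousAt (fun p : ℝ × ℂ × ℂ => conj p.2.1) (r, a, z) :=
    continuous_conj.continuousAt.comp hpa
  have key : ∀ w : ℝ × ℂ × ℂ → ℂ, ContinuousAt w (r, a, z) → ‖w (r, a, z)‖ < 1 →
      ContinuousAt (fun p => logQProduct (p.1 ^ 2) (w p)) (r, a, z) := fun w hw hlt =>
    ContinuousAt.comp' (f := fun p : ℝ × ℂ × ℂ => (p.1 ^ 2, w p)) (x := (r, a, z))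
      (continuousAt_logQProduct h.abs_sq_lt_one hlt) (hr.prodMk hw)
  have h1 := key _ (hrc.mul (hpz.div hpa ha)) h.norm_sq_mul_div_lt_one
  have h2 := key _ (hrc.mul (hpa.div hpz hz)) h.norm_sq_mul_div_lt_one'
  have h3 := key _ (hpc.mul hpz) h.norm_conj_mul_lt_one
  have h4 := key _ (hrc.div (hpc.mul hpz) (mul_ne_zero (by simpa using ha) hz))
    h.norm_sq_div_lt_one
  exact (continuousAt_const.sub (hpz.div hpa ha)).mul
    (continuous_exp.continuousAt.comp (((h1.add h2).sub h3).sub h4))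

theorem differentiableAt_logAnnulusFactor (h : IsRegularTriple r a z) :
    DifferentiableAt ℂ (logAnnulusFactor r a) z := by
  have ha := h.left_ne_zero
  have hz := h.right_ne_zero
  have ha' : conj a ≠ 0 := by simpa using ha
  have key : ∀ w : ℂ → ℂ, DifferentiableAt ℂ w z → ‖w z‖ < 1 →
      DifferentiableAt ℂ (fun z => logQProduct (r ^ 2) (w z)) z := fun w hw hlt =>
    DifferentiableAt.comp z (differentiableAt_logQProduct h.abs_sq_lt_one hlt) hw
  have hd : DifferentiableAt ℂ (fun z : ℂ => z) z := differentiableAt_id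
  have h1 := key _ ((hd.div_const a).const_mul (((r ^ 2 : ℝ) : ℂ))) h.norm_sq_mul_div_lt_one
  have h2 := key _ (((differentiableAt_const a).div hd hz).const_mul (((r ^ 2 : ℝ) : ℂ)))
    h.norm_sq_mul_div_lt_one'
  have h3 := key _ (hd.const_mul (conj a)) h.norm_conj_mul_lt_one
  have h4 := key _ ((differentiableAt_const (((r ^ 2 : ℝ) : ℂ))).div (hd.const_mul (conj a))
    (mul_ne_zero ha' hz)) h.norm_sq_div_lt_one
  exact ((h1.add h2).sub h3).sub h4

theorem differentiableAt_annulusFactor (h : IsRegularTriple r a z) :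
    DifferentiableAt ℂ (annulusFactor r a) z :=
  ((differentiableAt_const 1).sub (differentiableAt_id.div_const a)).mul
    h.differentiableAt_logAnnulusFactor.cexp

/-- On `|z| = 1` the reflection `z ↦ 1 / z̄` is the identity, so up to conjugation `ā z` is `a / z`
and `q / (ā z)` is `q z / a`, and the products cancel except for one factor. -/
theorem norm_annulusFactor_of_norm_eq_one (h : IsRegularTriple r a z) (hz : ‖z‖ = 1) :
    ‖annulusFactor r a z‖ = ‖a‖⁻¹ := by
  have ha := h.left_ne_zero
  have hz0 := h.right_ne_zero
  have hzc : conj z = z⁻¹ := by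
    rw [Complex.inv_def, Complex.normSq_eq_norm_sq, hz]; simp
  have h1 : conj a * z = conj (a / z) := by
    rw [map_div₀, hzc, div_inv_eq_mul]
  have h2 : ((r ^ 2 : ℝ) : ℂ) / (conj a * z) = conj (((r ^ 2 : ℝ) : ℂ) * (z / a)) := by
    rw [map_mul, map_div₀, hzc, conj_ofReal]; field_simp
  have h3 : ‖a / z‖ < 1 := by
    have := h.mul_lt_one
    rw [hz] at this
    rw [norm_div, hz]
    linarith
  have hne : z - a ≠ 0 := fun h0 => by
    rw [sub_eq_zero.1 h0, norm_div, div_self (norm_ne_zero_iff.2 ha)] at h3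
    exact lt_irrefl _ h3
  unfold annulusFactor logAnnulusFactor
  rw [exp_sub, exp_sub, exp_add, norm_mul, norm_div, norm_div, norm_mul, h2,
    norm_exp_logQProduct_conj h.abs_sq_lt_one h.norm_sq_mul_div_lt_one, h1,
    norm_exp_logQProduct_conj h.abs_sq_lt_one h3, exp_logQProduct h.abs_sq_lt_one h3, norm_mul]
  have e1 : 1 - z / a = -(z - a) / a := by field_simp; ring
  have e2 : 1 - a / z = (z - a) / z := by field_simp
  have n1 := norm_ne_zero_iff.2 (exp_ne_zero (logQProduct (r ^ 2) (((r ^ 2 : ℝ) : ℂ) * (z / a))))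
  have n2 := norm_ne_zero_iff.2 (exp_ne_zero (logQProduct (r ^ 2) (((r ^ 2 : ℝ) : ℂ) * (a / z))))
  have n3 := norm_ne_zero_iff.2 hne
  have n4 := norm_ne_zero_iff.2 ha
  rw [e1, e2, norm_div, norm_div, norm_neg, hz]
  field_simp

/-- The same cancellation as on the outer circle, with the reflection `z ↦ q / z̄` in `|z| = r`. -/
theorem norm_annulusFactor_of_norm_eq (h : IsRegularTriple r a z) (hz : ‖z‖ = r) :
    ‖annulusFactor r a z‖ = 1 := by
  have ha := h.left_ne_zero
  have hz0 := h.right_ne_zero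
  have hr0 : ((r ^ 2 : ℝ) : ℂ) ≠ 0 := by exact_mod_cast h.sq_pos.ne'
  have hzc : conj z = ((r ^ 2 : ℝ) : ℂ) / z := by
    rw [eq_div_iff hz0, mul_comm, mul_conj, Complex.normSq_eq_norm_sq, hz]
  have h1 : conj a * z = conj (((r ^ 2 : ℝ) : ℂ) * (a / z)) := by
    rw [map_mul, map_div₀, hzc, conj_ofReal]; field_simp
  have h2 : ((r ^ 2 : ℝ) : ℂ) / (conj a * z) = conj (z / a) := by
    rw [map_div₀, hzc]; field_simp
  have h3 : ‖z / a‖ < 1 := by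
    have := h.lt_mul
    have hr := h.r_pos
    rw [norm_div, div_lt_one (norm_pos_iff.2 ha), hz]
    rw [hz] at this
    nlinarith
  have hne : 1 - z / a ≠ 0 := slitPlane_ne_zero (one_sub_mem_slitPlane h3)
  unfold annulusFactor logAnnulusFactor
  rw [exp_sub, exp_sub, exp_add, norm_mul, norm_div, norm_div, norm_mul, h2,
    norm_exp_logQProduct_conj h.abs_sq_lt_one h3, h1,
    norm_exp_logQProduct_conj h.abs_sq_lt_one h.norm_sq_mul_div_lt_one',
    exp_logQProduct h.abs_sq_lt_one h3, norm_mul]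
  have n1 := norm_ne_zero_iff.2 (exp_ne_zero (logQProduct (r ^ 2) (((r ^ 2 : ℝ) : ℂ) * (z / a))))
  have n2 := norm_ne_zero_iff.2 (exp_ne_zero (logQProduct (r ^ 2) (((r ^ 2 : ℝ) : ℂ) * (a / z))))
  have n3 := norm_ne_zero_iff.2 hne
  generalize ‖1 - z / a‖ = x at *
  field_simp

end IsRegularTriple

theorem isRegularTriple_of_left_mem {r : ℝ} {a z : ℂ} (hr0 : 0 < r) (hr1 : r < 1)
    (ha : a ∈ annulus r) (hz : r ≤ ‖z‖) (hz' : ‖z‖ ≤ 1) : IsRegularTriple r a z where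
  r_pos := hr0
  r_lt_one := hr1
  sq_mul_norm_lt := by nlinarith [ha.1, ha.2]
  sq_mul_norm_lt' := by nlinarith [ha.1, ha.2]
  mul_lt_one := by nlinarith [ha.1, ha.2]
  lt_mul := by nlinarith [ha.1, ha.2]

theorem IsRegularTriple.symm {r : ℝ} {a z : ℂ} (h : IsRegularTriple r a z) :
    IsRegularTriple r z a where
  r_pos := h.r_pos
  r_lt_one := h.r_lt_one
  sq_mul_norm_lt := h.sq_mul_norm_lt'
  sq_mul_norm_lt' := h.sq_mul_norm_lt
  mul_lt_one := mul_comm ‖a‖ ‖z‖ ▸ h.mul_lt_one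
  lt_mul := mul_comm ‖a‖ ‖z‖ ▸ h.lt_mul

/-- The product of the factors with zeros `a k`, times `z ^ ℓ`. -/
noncomputable def annulusProduct {e : ℕ} (r : ℝ) (ℓ : ℤ) (a : Fin e → ℂ) (z : ℂ) : ℂ :=
  z ^ ℓ * ∏ k, annulusFactor r (a k) z

theorem annulusProduct_congr {e : ℕ} {r : ℝ} {ℓ : ℤ} {a b : Fin e → ℂ} (h : IsRearrangement a b)
    (z : ℂ) : annulusProduct r ℓ a z = annulusProduct r ℓ b z := by
  unfold annulusProduct
  rw [h.prod_eq fun w => annulusFactor r w z]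

theorem continuousAt_annulusProduct {e : ℕ} {r : ℝ} (ℓ : ℤ) {a : Fin e → ℂ} {z : ℂ} (hz : z ≠ 0)
    (h : ∀ k, IsRegularTriple r (a k) z) :
    ContinuousAt (fun p : (ℝ × (Fin e → ℂ)) × ℂ => annulusProduct p.1.1 ℓ p.1.2 p.2)
      ((r, a), z) := by
  refine ContinuousAt.mul (continuousAt_snd.zpow₀ ℓ (Or.inl hz)) ?_
  refine tendsto_finsetProd _ fun k _ => ?_
  exact ContinuousAt.comp' (f := fun p : (ℝ × (Fin e → ℂ)) × ℂ => (p.1.1, p.1.2 k, p.2))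
    (x := ((r, a), z)) (h k).continuousAt_annulusFactor (by fun_prop)

theorem differentiableAt_annulusProduct {e : ℕ} {r : ℝ} (ℓ : ℤ) {a : Fin e → ℂ} {z : ℂ}
    (hz : z ≠ 0) (h : ∀ k, IsRegularTriple r (a k) z) :
    DifferentiableAt ℂ (annulusProduct r ℓ a) z := by
  refine DifferentiableAt.mul (differentiableAt_zpow.2 (Or.inl hz)) ?_
  exact DifferentiableAt.fun_finsetProd fun k _ => (h k).differentiableAt_annulusFactor

theorem hasZeros_annulusProduct {e : ℕ} {r : ℝ} {ℓ : ℤ} {a : Fin e → ℂ} {c : ℂ} {f : ℂ → ℂ}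
    (hr0 : 0 < r) (hc : c ≠ 0) (h : ∀ z ∈ annulus r, ∀ k, IsRegularTriple r (a k) z)
    (hf : ∀ z ∈ annulus r, f z = c * annulusProduct r ℓ a z) : HasZeros (annulus r) f a := by
  have hz0 : ∀ z ∈ annulus r, z ≠ 0 := fun z hz => norm_pos_iff.1 (hr0.trans hz.1)
  refine ⟨fun z => c * (z ^ ℓ * ∏ k, (-(a k)⁻¹ * exp (logAnnulusFactor r (a k) z))), ?_, ?_, ?_⟩
  · intro z hz
    refine DifferentiableAt.differentiableWithinAt (DifferentiableAt.const_mul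
      (DifferentiableAt.mul (differentiableAt_zpow.2 (Or.inl (hz0 z hz)))
      (DifferentiableAt.fun_finsetProd fun k _ => DifferentiableAt.const_mul ?_ _)) _)
    exact (h z hz k).differentiableAt_logAnnulusFactor.cexp
  · intro z hz
    refine mul_ne_zero hc (mul_ne_zero (zpow_ne_zero _ (hz0 z hz)) ?_)
    exact Finset.prod_ne_zero_iff.2 fun k _ =>
      mul_ne_zero (neg_ne_zero.2 (inv_ne_zero (h z hz k).left_ne_zero)) (exp_ne_zero _)
  · intro z hz
    have : ∏ k, annulusFactor r (a k) z =
        (∏ k, (z - a k)) * ∏ k, (-(a k)⁻¹ * exp (logAnnulusFactor r (a k) z)) := by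
      rw [← Finset.prod_mul_distrib]
      refine Finset.prod_congr rfl fun k _ => ?_
      have := (h z hz k).left_ne_zero
      unfold annulusFactor
      field_simp
      ring
    rw [hf z hz, annulusProduct, this]
    ring

/-! ### Maximum principle on the annulus -/

/-- The closed annulus. -/
def closedAnnulus (r : ℝ) : Set ℂ := {z | r ≤ ‖z‖ ∧ ‖z‖ ≤ 1}

theorem isCompact_closedAnnulus (r : ℝ) : IsCompact (closedAnnulus r) := by
  refine Metric.isCompact_of_isClosed_isBounded
    ((isClosed_le continuous_const continuous_norm).inter
      (isClosed_le continuous_norm continuous_const)) ?_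
  exact isBounded_iff_forall_norm_le.2 ⟨1, fun z hz => hz.2⟩

theorem annulus_subset_closedAnnulus (r : ℝ) : annulus r ⊆ closedAnnulus r :=
  fun _ hz => ⟨hz.1.le, hz.2.le⟩

theorem neBot_nhdsWithin_annulus {r : ℝ} (hr0 : 0 < r) (hr1 : r < 1) {ζ : ℂ}
    (hζ : ‖ζ‖ = r ∨ ‖ζ‖ = 1) : NeBot (𝓝[annulus r] ζ) := by
  have hcont : Tendsto (fun t : ℝ => t • ζ) (𝓝 1) (𝓝 ζ) := by
    have : Continuous fun t : ℝ => t • ζ := by fun_prop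
    simpa using this.tendsto 1
  rcases hζ with hζ | hζ
  · have h : Tendsto (fun t : ℝ => t • ζ) (𝓝[>] 1) (𝓝[annulus r] ζ) := by
      refine tendsto_nhdsWithin_iff.2 ⟨hcont.mono_left nhdsWithin_le_nhds, ?_⟩
      filter_upwards [Ioo_mem_nhdsGT ((one_lt_inv₀ hr0).2 hr1)] with t ht
      have h0 : 0 < t := one_pos.trans ht.1
      have h1 : t * r < 1 := by
        have := mul_lt_mul_of_pos_right ht.2 hr0
        rwa [inv_mul_cancel₀ hr0.ne'] at this
      refine ⟨?_, ?_⟩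
      · rw [norm_smul, Real.norm_of_nonneg h0.le, hζ]
        nlinarith [ht.1]
      · rwa [norm_smul, Real.norm_of_nonneg h0.le, hζ]
    exact h.neBot
  · have h : Tendsto (fun t : ℝ => t • ζ) (𝓝[<] 1) (𝓝[annulus r] ζ) := by
      refine tendsto_nhdsWithin_iff.2 ⟨hcont.mono_left nhdsWithin_le_nhds, ?_⟩
      filter_upwards [Ioo_mem_nhdsLT hr1] with t ht
      have h0 : 0 < t := hr0.trans ht.1
      refine ⟨?_, ?_⟩ <;> rw [norm_smul, Real.norm_of_nonneg h0.le, hζ, mul_one]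
      exacts [ht.1, ht.2]
    exact h.neBot

/-- The exponential function is a universal covering of the annulus by this strip. -/
def strip (r : ℝ) : Set ℂ := {w | Real.log r < w.re ∧ w.re < 0}

theorem isOpen_strip (r : ℝ) : IsOpen (strip r) :=
  (isOpen_lt continuous_const continuous_re).inter (isOpen_lt continuous_re continuous_const)

theorem isPreconnected_strip (r : ℝ) : IsPreconnected (strip r) :=
  ((convex_halfSpace_re_gt _).inter (convex_halfSpace_re_lt _)).isPreconnected

theorem exp_mem_annulus {r : ℝ} (hr0 : 0 < r) {w : ℂ} (hw : w ∈ strip r) :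
    exp w ∈ annulus r := by
  refine ⟨?_, ?_⟩ <;> rw [norm_exp]
  · exact (Real.log_lt_iff_lt_exp hr0).1 hw.1
  · simpa using hw.2

theorem log_mem_strip {r : ℝ} (hr0 : 0 < r) {z : ℂ} (hz : z ∈ annulus r) :
    Complex.log z ∈ strip r := by
  refine ⟨?_, ?_⟩ <;> rw [log_re]
  · exact Real.log_lt_log hr0 hz.1
  · exact Real.log_neg (hr0.trans hz.1) hz.2

theorem ne_zero_of_mem_annulus {r : ℝ} (hr0 : 0 < r) {z : ℂ} (hz : z ∈ annulus r) : z ≠ 0 :=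
  norm_pos_iff.1 (hr0.trans hz.1)

theorem isPreconnected_annulus {r : ℝ} (hr0 : 0 < r) : IsPreconnected (annulus r) := by
  have h : annulus r = exp '' strip r := by
    ext z
    constructor
    · intro hz
      exact ⟨_, log_mem_strip hr0 hz, exp_log (ne_zero_of_mem_annulus hr0 hz)⟩
    · rintro ⟨w, hw, rfl⟩
      exact exp_mem_annulus hr0 hw
  rw [h]
  exact (isPreconnected_strip r).image _ continuous_exp.continuousOn

theorem norm_comp_exp_mul_exp (g : ℂ → ℂ) (α : ℝ) (w : ℂ) :
    ‖g (exp w) * exp (-α * w)‖ = ‖g (exp w)‖ * ‖exp w‖ ^ (-α) := by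
  rw [norm_mul, norm_exp, norm_exp, ← Real.exp_mul]
  simp [mul_comm]

theorem differentiableOn_comp_exp_mul_exp {r : ℝ} (hr0 : 0 < r) {g : ℂ → ℂ}
    (hg : DifferentiableOn ℂ g (annulus r)) (α : ℝ) :
    DifferentiableOn ℂ (fun w => g (exp w) * exp (-α * w)) (strip r) := by
  refine DifferentiableOn.mul (hg.comp differentiable_exp.differentiableOn fun w hw =>
    exp_mem_annulus hr0 hw) (Differentiable.differentiableOn (by fun_prop))

/-- The maximum principle for the multivalued function `g z * z ^ (-α)`, whose modulus is
single-valued. -/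
theorem norm_mul_rpow_le_of_tendsto {r : ℝ} (hr0 : 0 < r) (hr1 : r < 1) {g : ℂ → ℂ}
    (hg : DifferentiableOn ℂ g (annulus r)) (α K : ℝ)
    (hK : ∀ ζ : ℂ, ‖ζ‖ = r ∨ ‖ζ‖ = 1 →
      Tendsto (fun z => ‖g z‖ * ‖z‖ ^ (-α)) (𝓝[annulus r] ζ) (𝓝 K)) {z : ℂ}
    (hz : z ∈ annulus r) : ‖g z‖ * ‖z‖ ^ (-α) ≤ K := by
  classical
  have hopen := AnnulusDiskMap.isOpen_annulus r
  set u : ℂ → ℝ := fun z => ‖g z‖ * ‖z‖ ^ (-α) with hu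
  set φ : ℂ → ℝ := fun z => if z ∈ annulus r then u z else K with hφ
  have hφu : ∀ ζ ∈ annulus r, φ ζ = u ζ := fun ζ hζ => if_pos hζ
  have hbd : ∀ ζ ∈ closedAnnulus r, ζ ∉ annulus r → ‖ζ‖ = r ∨ ‖ζ‖ = 1 := by
    intro ζ hζ hn
    by_contra! hcon
    exact hn ⟨lt_of_le_of_ne hζ.1 hcon.1.symm, lt_of_le_of_ne hζ.2 hcon.2⟩
  have hcont : ContinuousOn φ (closedAnnulus r) := by
    intro ζ hζ
    by_cases hζa : ζ ∈ annulus r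
    · have hua : ContinuousAt u ζ := by
        refine ContinuousAt.mul (hg.continuousOn.continuousAt (hopen.mem_nhds hζa)).norm ?_
        exact continuous_norm.continuousAt.rpow_const
          (Or.inl (norm_ne_zero_iff.2 (ne_zero_of_mem_annulus hr0 hζa)))
      refine (hua.congr ?_).continuousWithinAt
      filter_upwards [hopen.mem_nhds hζa] with w hw using (hφu w hw).symm
    · have hsplit : closedAnnulus r ⊆ annulus r ∪ (annulus r)ᶜ := by simp
      refine ContinuousWithinAt.mono ?_ hsplit
      change Tendsto φ (𝓝[annulus r ∪ (annulus r)ᶜ] ζ) (𝓝 (φ ζ))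
      rw [nhdsWithin_union, tendsto_sup]
      have hφζ : φ ζ = K := if_neg hζa
      rw [hφζ]
      constructor
      · refine (hK ζ (hbd ζ hζ hζa)).congr' ?_
        filter_upwards [self_mem_nhdsWithin] with w hw using (hφu w hw).symm
      · refine tendsto_const_nhds.congr' ?_
        filter_upwards [self_mem_nhdsWithin] with w hw using (if_neg hw).symm
  obtain ⟨z₀, hz₀, hmax⟩ := (isCompact_closedAnnulus r).exists_isMaxOn
    ⟨z, annulus_subset_closedAnnulus r hz⟩ hcont
  by_contra! hlt
  have hlt' : K < φ z₀ := by
    exact hlt.trans_le ((hφu z hz).ge.trans (hmax (annulus_subset_closedAnnulus r hz)))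
  have hz₀a : z₀ ∈ annulus r := by
    by_contra hn
    rw [hφ] at hlt'
    simp [hn] at hlt'
  have hw₀ := log_mem_strip hr0 hz₀a
  have hexp : exp (Complex.log z₀) = z₀ := exp_log (ne_zero_of_mem_annulus hr0 hz₀a)
  have hconst := Complex.eqOn_of_isPreconnected_of_isMaxOn_norm (isPreconnected_strip r)
    (isOpen_strip r) (differentiableOn_comp_exp_mul_exp hr0 hg α) hw₀ (by
      intro w hw
      simp only [Function.comp_apply, mem_ofPred_eq]
      rw [norm_comp_exp_mul_exp, norm_comp_exp_mul_exp, hexp]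
      have := hmax (annulus_subset_closedAnnulus r (exp_mem_annulus hr0 hw))
      rw [mem_ofPred_eq, hφu _ hz₀a, hφu _ (exp_mem_annulus hr0 hw)] at this
      exact this)
  have huc : ∀ w ∈ annulus r, u w = u z₀ := by
    intro w hw
    have h1 := congrArg norm (hconst (log_mem_strip hr0 hw))
    simp only [Function.const_apply] at h1
    rwa [norm_comp_exp_mul_exp, norm_comp_exp_mul_exp, hexp,
      exp_log (ne_zero_of_mem_annulus hr0 hw)] at h1
  have := neBot_nhdsWithin_annulus hr0 hr1 (ζ := 1) (Or.inr norm_one)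
  have h2 : Tendsto u (𝓝[annulus r] 1) (𝓝 (u z₀)) := by
    refine tendsto_const_nhds.congr' ?_
    filter_upwards [self_mem_nhdsWithin] with w hw using (huc w hw).symm
  rw [hφu _ hz₀a, ← tendsto_nhds_unique (hK 1 (Or.inr norm_one)) h2] at hlt'
  exact lt_irrefl _ hlt'

/-- A zero-free holomorphic function whose modulus has constant boundary values on the two
boundary circles is a monomial: on the universal cover, `g z * z ^ (-α)` is constant for a suitable
real exponent `α`, which must be an integer because `g` is single-valued. -/
theorem eq_zpow_of_tendsto {r : ℝ} (hr0 : 0 < r) (hr1 : r < 1) {g : ℂ → ℂ}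
    (hg : DifferentiableOn ℂ g (annulus r)) (hg0 : ∀ z ∈ annulus r, g z ≠ 0) (α K : ℝ) (hK0 : 0 < K)
    (hK : ∀ ζ : ℂ, ‖ζ‖ = r ∨ ‖ζ‖ = 1 →
      Tendsto (fun z => ‖g z‖ * ‖z‖ ^ (-α)) (𝓝[annulus r] ζ) (𝓝 K)) :
    ∃ (ℓ : ℤ) (C : ℂ), α = ℓ ∧ ‖C‖ = K ∧ ∀ z ∈ annulus r, g z = C * z ^ ℓ := by
  have hinv : ∀ z : ℂ, ‖(g z)⁻¹‖ * ‖z‖ ^ (-(-α)) = (‖g z‖ * ‖z‖ ^ (-α))⁻¹ := fun z => by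
    rw [mul_inv, norm_inv, neg_neg, Real.rpow_neg (norm_nonneg z), inv_inv]
  have hnorm : ∀ z ∈ annulus r, ‖g z‖ * ‖z‖ ^ (-α) = K := by
    intro z hz
    refine le_antisymm (norm_mul_rpow_le_of_tendsto hr0 hr1 hg α K hK hz) ?_
    have h := norm_mul_rpow_le_of_tendsto hr0 hr1 (hg.inv hg0) (-α) K⁻¹ (fun ζ hζ => by
      simp only [Pi.inv_apply, hinv]
      exact (hK ζ hζ).inv₀ hK0.ne') hz
    simp only [Pi.inv_apply, hinv] at h
    have hpos : 0 < ‖g z‖ * ‖z‖ ^ (-α) := mul_pos (norm_pos_iff.2 (hg0 z hz))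
      (Real.rpow_pos_of_pos (hr0.trans hz.1) _)
    exact (inv_le_inv₀ hpos hK0).1 h
  obtain ⟨x, hx1, hx2⟩ := exists_between (Real.log_neg hr0 hr1)
  have hw : ∀ t : ℝ, (x + t * I : ℂ) ∈ strip r := fun t => by simp [strip, hx1, hx2]
  have hw₀ : (x : ℂ) ∈ strip r := by simp [strip, hx1, hx2]
  have hconst := Complex.eqOn_of_isPreconnected_of_isMaxOn_norm (isPreconnected_strip r)
    (isOpen_strip r) (differentiableOn_comp_exp_mul_exp hr0 hg α) hw₀ (by
      intro w hw
      simp only [Function.comp_apply, mem_ofPred_eq]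
      rw [norm_comp_exp_mul_exp, norm_comp_exp_mul_exp, hnorm _ (exp_mem_annulus hr0 hw),
        hnorm _ (exp_mem_annulus hr0 hw₀)])
  set C : ℂ := g (exp x) * exp (-α * x) with hC
  have hCn : ‖C‖ = K := by
    rw [hC, norm_comp_exp_mul_exp, hnorm _ (exp_mem_annulus hr0 hw₀)]
  have hgC : ∀ w ∈ strip r, g (exp w) = C * exp (α * w) := by
    intro w hw
    have h1 : g (exp w) * exp (-α * w) = C := hconst hw
    rw [← h1, mul_assoc, ← exp_add]
    simp
  -- comparing the values at `x` and `x + 2πi` shows that `α` is an integer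
  obtain ⟨ℓ, hℓ⟩ : ∃ ℓ : ℤ, α = ℓ := by
    have h1 := hgC _ (hw (2 * Real.pi))
    have h2 : exp (x + ((2 * Real.pi : ℝ) : ℂ) * I) = exp x := by
      push_cast
      exact exp_periodic x
    rw [h2, hgC _ hw₀] at h1
    have h3 := mul_left_cancel₀ (norm_pos_iff.1 (hCn ▸ hK0)) h1
    rw [mul_add, exp_add, left_eq_mul₀ (exp_ne_zero _), exp_eq_one_iff] at h3
    obtain ⟨ℓ, hℓ⟩ := h3
    refine ⟨ℓ, ?_⟩
    have hpi : (2 * Real.pi * I : ℂ) ≠ 0 := two_pi_I_ne_zero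
    have : (α : ℂ) * (2 * Real.pi * I) = ℓ * (2 * Real.pi * I) := by
      rw [← hℓ]; push_cast; ring
    exact_mod_cast mul_right_cancel₀ hpi this
  refine ⟨ℓ, C, hℓ, hCn, fun z hz => ?_⟩
  have h1 := hgC _ (log_mem_strip hr0 hz)
  rw [exp_log (ne_zero_of_mem_annulus hr0 hz)] at h1
  rw [h1, hℓ, ofReal_intCast, exp_int_mul, exp_log (ne_zero_of_mem_annulus hr0 hz)]

/-! ### Inner degree of products of annular factors -/

theorem norm_annulusProduct_of_norm_eq_one {e : ℕ} {r : ℝ} {ℓ : ℤ} {a : Fin e → ℂ} {z : ℂ}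
    (hr0 : 0 < r) (hr1 : r < 1) (ha : ∀ k, a k ∈ annulus r) (hz : ‖z‖ = 1) :
    ‖annulusProduct r ℓ a z‖ = (∏ k, ‖a k‖)⁻¹ := by
  rw [annulusProduct, norm_mul, norm_zpow, hz, one_zpow, one_mul, norm_prod,
    ← Finset.prod_inv_distrib]
  exact Finset.prod_congr rfl fun k _ => (isRegularTriple_of_left_mem hr0 hr1 (ha k)
    (hz ▸ hr1.le) hz.le).norm_annulusFactor_of_norm_eq_one hz

theorem norm_annulusProduct_of_norm_eq {e : ℕ} {r : ℝ} {ℓ : ℤ} {a : Fin e → ℂ} {z : ℂ}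
    (hr0 : 0 < r) (hr1 : r < 1) (ha : ∀ k, a k ∈ annulus r) (hz : ‖z‖ = r) :
    ‖annulusProduct r ℓ a z‖ = r ^ ℓ := by
  rw [annulusProduct, norm_mul, norm_zpow, hz, norm_prod, Finset.prod_eq_one, mul_one]
  exact fun k _ => (isRegularTriple_of_left_mem hr0 hr1 (ha k)
    hz.ge (hz ▸ hr1.le)).norm_annulusFactor_of_norm_eq hz

theorem norm_innerCircle {r : ℝ} (hr0 : 0 < r) (t : ℝ) : ‖(r : ℂ) * exp (-(t * I))‖ = r := by
  rw [norm_mul, norm_exp, Complex.norm_real, Real.norm_of_nonneg hr0.le]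
  simp

/-- A continuous logarithm along the clockwise inner circle, where all the factors `1 - z / a k`
stay in the right half plane, so that only the monomial contributes to the winding. -/
theorem exists_log_annulusProduct {e : ℕ} {r : ℝ} {ℓ : ℤ} {a : Fin e → ℂ} {c : ℂ}
    (hr0 : 0 < r) (hr1 : r < 1) (ha : ∀ k, a k ∈ annulus r) (hc : c ≠ 0) :
    ∃ Λ : ℝ → ℂ, Continuous Λ ∧
      (∀ t : ℝ, exp (Λ t) = c * annulusProduct r ℓ a (r * exp (-(t * I)))) ∧
      ∀ t : ℝ, Λ (t + 2 * Real.pi) = Λ t - 2 * Real.pi * ℓ * I := by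
  set ζ : ℝ → ℂ := fun t => r * exp (-(t * I)) with hζ
  have hζc : Continuous ζ := by fun_prop
  have hζn : ∀ t, ‖ζ t‖ = r := norm_innerCircle hr0
  have hζp : ∀ t : ℝ, ζ (t + 2 * Real.pi) = ζ t := fun t => by
    simp only [hζ]
    congr 1
    have := exp_periodic.sub_eq (-(t * I))
    rw [← this]
    push_cast
    ring_nf
  have hreg : ∀ k t, IsRegularTriple r (a k) (ζ t) := fun k t =>
    isRegularTriple_of_left_mem hr0 hr1 (ha k) (hζn t).ge ((hζn t).trans_le hr1.le)
  have hlt : ∀ k t, ‖ζ t / a k‖ < 1 := fun k t => by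
    rw [norm_div, hζn, div_lt_one (hr0.trans (ha k).1)]
    exact (ha k).1
  refine ⟨fun t => Complex.log c + ℓ * (Real.log r - t * I) +
    ∑ k, (Complex.log (1 - ζ t / a k) + logAnnulusFactor r (a k) (ζ t)), ?_, fun t => ?_,
    fun t => ?_⟩
  · refine Continuous.add (by fun_prop) (continuous_finsetSum _ fun k _ => Continuous.add ?_ ?_)
    · exact Continuous.clog (continuous_const.sub (hζc.div_const _))
        fun t => one_sub_mem_slitPlane (hlt k t)
    · exact continuous_iff_continuousAt.2 fun t =>
        ((hreg k t).differentiableAt_logAnnulusFactor.continuousAt).comp hζc.continuousAt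
  · have h1 : exp (ℓ * (Real.log r - t * I)) = ζ t ^ ℓ := by
      rw [exp_int_mul, sub_eq_add_neg, exp_add, ← ofReal_exp, Real.exp_log hr0]
    rw [exp_add, exp_add, exp_log hc, h1, exp_sum, annulusProduct, mul_assoc]
    congr 2
    refine Finset.prod_congr rfl fun k _ => ?_
    rw [exp_add, exp_log (slitPlane_ne_zero (one_sub_mem_slitPlane (hlt k t)))]
    rfl
  · simp only [hζp]
    push_cast
    ring

theorem tendsto_of_eq_annulusProduct {e : ℕ} {r : ℝ} {ℓ : ℤ} {a : Fin e → ℂ} {c : ℂ} {f : ℂ → ℂ}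
    (hr0 : 0 < r) (hr1 : r < 1) (ha : ∀ k, a k ∈ annulus r)
    (hf : ∀ z ∈ annulus r, f z = c * annulusProduct r ℓ a z) {ζ : ℂ} (hζ : ζ ∈ closedAnnulus r) :
    Tendsto f (𝓝[annulus r] ζ) (𝓝 (c * annulusProduct r ℓ a ζ)) := by
  have h1 : ContinuousAt (annulusProduct r ℓ a) ζ :=
    (differentiableAt_annulusProduct ℓ (norm_pos_iff.1 (hr0.trans_le hζ.1)) fun k =>
      isRegularTriple_of_left_mem hr0 hr1 (ha k) hζ.1 hζ.2).continuousAt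
  have h2 : Tendsto (fun z => c * annulusProduct r ℓ a z) (𝓝[annulus r] ζ)
      (𝓝 (c * annulusProduct r ℓ a ζ)) := (continuousAt_const.mul h1).mono_left nhdsWithin_le_nhds
  refine h2.congr' ?_
  filter_upwards [self_mem_nhdsWithin] with z hz using (hf z hz).symm

theorem hasInnerDegree_of_eq_annulusProduct {e δ : ℕ} {r : ℝ} {a : Fin e → ℂ} {c : ℂ}
    {f : ℂ → ℂ} (hr0 : 0 < r) (hr1 : r < 1) (ha : ∀ k, a k ∈ annulus r) (hc : ‖c‖ = r ^ δ)
    (hf : ∀ z ∈ annulus r, f z = c * annulusProduct r (-δ) a z) : HasInnerDegree r f δ := by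
  have hc0 : c ≠ 0 := norm_pos_iff.1 (hc ▸ pow_pos hr0 δ)
  obtain ⟨Λ, hΛ, hexp, hper⟩ := exists_log_annulusProduct (ℓ := -δ) hr0 hr1 ha hc0
  have hre : ∀ t, (Λ t).re = 0 := fun t => by
    have h1 := congrArg norm (hexp t)
    rw [norm_exp, norm_mul, hc, norm_annulusProduct_of_norm_eq hr0 hr1 ha (norm_innerCircle hr0 t),
      zpow_neg, zpow_natCast, mul_inv_cancel₀ (pow_pos hr0 δ).ne'] at h1
    simpa using h1
  refine ⟨fun t => (Λ t).im, continuous_im.comp hΛ, fun t => ?_, fun t => ?_⟩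
  · have hmem : (r : ℂ) * exp (-(t * I)) ∈ closedAnnulus r :=
      ⟨(norm_innerCircle hr0 t).ge, (norm_innerCircle hr0 t).trans_le hr1.le⟩
    have h1 := tendsto_of_eq_annulusProduct hr0 hr1 ha hf hmem
    have h2 : ((Λ t).im * I : ℂ) = Λ t := by
      apply Complex.ext <;> simp [hre]
    rwa [h2, hexp]
  · simp [hper]

/-- The inner degree is well defined: two lifts differ by a constant. -/
theorem eq_neg_of_hasInnerDegree {e δ : ℕ} {r : ℝ} {ℓ : ℤ} {a : Fin e → ℂ} {c : ℂ}
    {f : ℂ → ℂ} (hr0 : 0 < r) (hr1 : r < 1) (ha : ∀ k, a k ∈ annulus r) (hc : c ≠ 0)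
    (hf : ∀ z ∈ annulus r, f z = c * annulusProduct r ℓ a z) (hδ : HasInnerDegree r f δ) :
    ℓ = -δ := by
  obtain ⟨Λ, hΛ, hexp, hper⟩ := exists_log_annulusProduct (ℓ := ℓ) hr0 hr1 ha hc
  obtain ⟨θ, hθ, hlim, hθper⟩ := hδ
  have h1 : ∀ t : ℝ, ∃ n : ℤ, (θ t * I : ℂ) = Λ t + n * (2 * Real.pi * I) := fun t => by
    have hmem : (r : ℂ) * exp (-(t * I)) ∈ closedAnnulus r :=
      ⟨(norm_innerCircle hr0 t).ge, (norm_innerCircle hr0 t).trans_le hr1.le⟩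
    have := neBot_nhdsWithin_annulus hr0 hr1 (Or.inl (norm_innerCircle hr0 t))
    have h2 := tendsto_nhds_unique (hlim t) (tendsto_of_eq_annulusProduct hr0 hr1 ha hf hmem)
    rw [← hexp] at h2
    exact exp_eq_exp_iff_exists_int.1 h2
  choose n hn using h1
  have hpi := Real.pi_pos
  have him : ∀ t, θ t = (Λ t).im + n t * (2 * Real.pi) := fun t => by
    simpa using congrArg Complex.im (hn t)
  have hncont : Continuous n := by
    refine Int.isClosedEmbedding_coe_real.isEmbedding.continuous_iff.2 ?_
    have : (Int.cast ∘ n : ℝ → ℝ) = fun t => (θ t - (Λ t).im) / (2 * Real.pi) := by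
      ext t
      rw [Function.comp_apply, him t]
      field_simp
      ring
    rw [this]
    exact (hθ.sub (continuous_im.comp hΛ)).div_const _
  have hconst : n (0 + 2 * Real.pi) = n 0 := PreconnectedSpace.constant inferInstance hncont
  have h2 := him (0 + 2 * Real.pi)
  rw [hconst, hθper, hper, him 0] at h2
  simp at h2
  have h3 : 2 * Real.pi * ((ℓ : ℝ) + δ) = 0 := by linarith
  have h4 : (ℓ : ℝ) + δ = 0 := by
    rcases mul_eq_zero.1 h3 with h | h
    · linarith
    · exact h
  have h5 : ℓ + δ = 0 := by exact_mod_cast h4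
  omega

/-! ### The zeros of a proper map -/

namespace AnnulusDiskMap

variable {e δ : ℕ}

theorem ext_of_eqOn {φ ψ : AnnulusDiskMap e δ} (hr : φ.r = ψ.r)
    (h : ∀ z ∈ annulus φ.r, φ.toFun z = ψ.toFun z) : φ = ψ := by
  have hf : φ.toFun = ψ.toFun := by
    ext z
    by_cases hz : z ∈ annulus φ.r
    · exact h z hz
    · rw [φ.eq_zero_of_notMem z hz, ψ.eq_zero_of_notMem z (hr ▸ hz)]
  cases φ
  cases ψ
  simp only at hr hf
  subst hr hf
  rfl

/-- A proper map tends to the boundary of the disk at the boundary of the annulus. -/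
theorem tendsto_norm_one (φ : AnnulusDiskMap e δ) {ζ : ℂ} (hζ : ‖ζ‖ = φ.r ∨ ‖ζ‖ = 1) :
    Tendsto (fun z => ‖φ.toFun z‖) (𝓝[annulus φ.r] ζ) (𝓝 1) := by
  have hζn : ζ ∉ annulus φ.r := fun h => by
    rcases hζ with h1 | h1
    · exact h.1.ne' h1
    · exact h.2.ne h1
  refine tendsto_order.2 ⟨fun s hs => ?_, fun s hs => ?_⟩
  · have hK := φ.proper (Metric.closedBall 0 s) (Metric.closedBall_subset_ball hs)
      (isCompact_closedBall 0 s)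
    have h1 : (annulus φ.r ∩ φ.toFun ⁻¹' Metric.closedBall 0 s)ᶜ ∈ 𝓝[annulus φ.r] ζ :=
      nhdsWithin_le_nhds (hK.isClosed.isOpen_compl.mem_nhds fun h => hζn h.1)
    filter_upwards [h1, self_mem_nhdsWithin] with z hz hz'
    by_contra! hcon
    exact hz ⟨hz', by simpa using hcon⟩
  · filter_upwards [self_mem_nhdsWithin] with z hz
    exact (mem_ball_zero_iff.1 (φ.mapsTo hz)).trans hs

/-- A map that vanishes identically near every point would have zero count `0`, by the convention
for infinite orders. -/
theorem exists_analyticOrderAt_ne_top (φ : AnnulusDiskMap e δ) (he : 0 < e) :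
    ∃ z ∈ annulus φ.r, analyticOrderAt φ.toFun z ≠ ⊤ := by
  by_contra! hcon
  have h := φ.degree_eq
  rw [zeroCount, finsum_mem_congr rfl fun z hz => by
    rw [analyticOrderNatAt, hcon z hz, ENat.toNat_top], finsum_mem_zero] at h
  omega

theorem analyticOnNhd (φ : AnnulusDiskMap e δ) : AnalyticOnNhd ℂ φ.toFun (annulus φ.r) :=
  φ.holomorphic.analyticOnNhd (isOpen_annulus _)

theorem analyticOrderAt_ne_top (φ : AnnulusDiskMap e δ) (he : 0 < e) {z : ℂ}
    (hz : z ∈ annulus φ.r) : analyticOrderAt φ.toFun z ≠ ⊤ := by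
  obtain ⟨w, hw, h⟩ := φ.exists_analyticOrderAt_ne_top he
  exact φ.analyticOnNhd.analyticOrderAt_ne_top_of_isPreconnected
    (isPreconnected_annulus φ.r_pos) hw hz h

theorem finite_zeros (φ : AnnulusDiskMap e δ) (he : 0 < e) :
    {z ∈ annulus φ.r | φ.toFun z = 0}.Finite := by
  by_contra hinf
  have hK := φ.proper {0} (by simp) isCompact_singleton
  obtain ⟨z, hz, hacc⟩ := Set.Infinite.exists_accPt_of_subset_isCompact
    (s := {z ∈ annulus φ.r | φ.toFun z = 0}) hinf hK fun z hz => hz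
  have hfreq : ∃ᶠ w in 𝓝[≠] z, φ.toFun w = 0 := by
    rw [frequently_nhdsWithin_iff]
    exact (accPt_iff_frequently.1 hacc).mono fun w hw => ⟨hw.2.2, hw.1⟩
  have h1 := φ.analyticOnNhd.eqOn_zero_of_preconnected_of_frequently_eq_zero
    (isPreconnected_annulus φ.r_pos) hz.1 hfreq
  refine φ.analyticOrderAt_ne_top he hz.1 (analyticOrderAt_eq_top.2 ?_)
  filter_upwards [(isOpen_annulus φ.r).mem_nhds hz.1] with w hw using h1 hw

/-- Every proper map is a constant multiple of the product of annular factors at its zeros: the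
quotient of the two is zero-free with constant boundary moduli, hence a monomial, whose exponent is
read off from the inner degree. Comparing the moduli on the two circles gives the constraint on the
zeros. -/
theorem exists_eq_annulusProduct (φ : AnnulusDiskMap e δ) (he : 0 < e) :
    ∃ a : Fin e → ℂ, (∀ k, a k ∈ annulus φ.r) ∧ ∏ k, ‖a k‖ = φ.r ^ δ ∧
      ∃ c : ℂ, ∀ z ∈ annulus φ.r, φ.toFun z = c * annulusProduct φ.r (-δ) a z := by
  have hr0 := φ.r_pos
  have hr1 := φ.r_lt_one
  have hne := fun z (hz : z ∈ annulus φ.r) => ne_zero_of_mem_annulus hr0 hz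
  obtain ⟨a, ha, G, hG, hG0, hfG⟩ := exists_hasZeros_of_zeroCount_eq φ.holomorphic
    (φ.finite_zeros he) (fun z hz => φ.analyticOrderAt_ne_top he hz) φ.degree_eq
  have hreg : ∀ k, ∀ z ∈ closedAnnulus φ.r, IsRegularTriple φ.r (a k) z := fun k z hz =>
    isRegularTriple_of_left_mem hr0 hr1 (ha k) hz.1 hz.2
  have hsub := annulus_subset_closedAnnulus φ.r
  set g : ℂ → ℂ := fun z => G z * ∏ k, (-(a k) * exp (-logAnnulusFactor φ.r (a k) z)) with hg
  have hgd : DifferentiableOn ℂ g (annulus φ.r) := by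
    intro z hz
    refine DifferentiableWithinAt.mul (hG z hz) (DifferentiableAt.differentiableWithinAt
      (DifferentiableAt.fun_finsetProd fun k _ => DifferentiableAt.const_mul ?_ _))
    exact (hreg k z (hsub hz)).differentiableAt_logAnnulusFactor.neg.cexp
  have hg0 : ∀ z ∈ annulus φ.r, g z ≠ 0 := fun z hz =>
    mul_ne_zero (hG0 z hz) (Finset.prod_ne_zero_iff.2 fun k _ =>
      mul_ne_zero (neg_ne_zero.2 (hne _ (ha k))) (exp_ne_zero _))
  have hfg : ∀ z ∈ annulus φ.r, φ.toFun z = g z * annulusProduct φ.r 0 a z := by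
    intro z hz
    have h1 : ∏ k, (z - a k) = (∏ k, (-(a k) * exp (-logAnnulusFactor φ.r (a k) z))) *
        annulusProduct φ.r 0 a z := by
      rw [annulusProduct, zpow_zero, one_mul, ← Finset.prod_mul_distrib]
      refine Finset.prod_congr rfl fun k _ => ?_
      have h0 := hne _ (ha k)
      have h2 := exp_ne_zero (logAnnulusFactor φ.r (a k) z)
      unfold annulusFactor
      rw [exp_neg]
      field_simp
      ring
    rw [hfG z hz, h1, hg]
    ring
  set K := ∏ k, ‖a k‖ with hK
  have hK0 : 0 < K := Finset.prod_pos fun k _ => hr0.trans (ha k).1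
  -- the exponent for which `‖g z‖ * ‖z‖ ^ (-α)` has boundary value `K` on both circles
  set α : ℝ := -(Real.log K / Real.log φ.r) with hα
  have hlog : Real.log φ.r ≠ 0 := (Real.log_neg hr0 hr1).ne
  have hrα : φ.r ^ (-α) = K := by
    rw [hα, neg_neg, Real.rpow_def_of_pos hr0, mul_div_cancel₀ _ hlog, Real.exp_log hK0]
  have hlim : ∀ ζ : ℂ, ‖ζ‖ = φ.r ∨ ‖ζ‖ = 1 →
      Tendsto (fun z => ‖g z‖ * ‖z‖ ^ (-α)) (𝓝[annulus φ.r] ζ) (𝓝 K) := by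
    intro ζ hζ
    have hζc : ζ ∈ closedAnnulus φ.r := by
      rcases hζ with h | h
      · exact ⟨h.ge, h.trans_le hr1.le⟩
      · exact ⟨h ▸ hr1.le, h.le⟩
    have hζ0 : ζ ≠ 0 := norm_pos_iff.1 (hr0.trans_le hζc.1)
    have hval : ‖annulusProduct φ.r 0 a ζ‖ ≠ 0 ∧
        1 / ‖annulusProduct φ.r 0 a ζ‖ * ‖ζ‖ ^ (-α) = K := by
      rcases hζ with h | h
      · rw [norm_annulusProduct_of_norm_eq hr0 hr1 ha h, h, hrα]
        simp
      · rw [norm_annulusProduct_of_norm_eq_one hr0 hr1 ha h, h, ← hK, one_div, inv_inv,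
          Real.one_rpow, mul_one]
        exact ⟨inv_ne_zero hK0.ne', rfl⟩
    have hP : ContinuousAt (annulusProduct φ.r 0 a) ζ :=
      (differentiableAt_annulusProduct 0 hζ0 fun k => hreg k ζ hζc).continuousAt
    have h1 : Tendsto (fun z => ‖φ.toFun z‖ / ‖annulusProduct φ.r 0 a z‖ * ‖z‖ ^ (-α))
        (𝓝[annulus φ.r] ζ) (𝓝 K) := by
      rw [← hval.2]
      refine ((φ.tendsto_norm_one hζ).div (hP.norm.mono_left nhdsWithin_le_nhds) hval.1).mul ?_
      exact (continuous_norm.continuousAt.rpow_const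
        (Or.inl (norm_ne_zero_iff.2 hζ0))).mono_left nhdsWithin_le_nhds
    refine h1.congr' ?_
    filter_upwards [self_mem_nhdsWithin,
      nhdsWithin_le_nhds (hP.eventually_ne (norm_ne_zero_iff.1 hval.1))] with z hz hz0
    rw [hfg z hz, norm_mul, mul_div_cancel_right₀ _ (norm_ne_zero_iff.2 hz0)]
  obtain ⟨ℓ, c, hℓ, hc, hgc⟩ := eq_zpow_of_tendsto hr0 hr1 hgd hg0 α K hK0 hlim
  have hc0 : c ≠ 0 := norm_pos_iff.1 (hc ▸ hK0)
  have hφ : ∀ z ∈ annulus φ.r, φ.toFun z = c * annulusProduct φ.r ℓ a z := by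
    intro z hz
    rw [hfg z hz, hgc z hz, annulusProduct, annulusProduct, zpow_zero, one_mul, mul_assoc]
  have hδ := eq_neg_of_hasInnerDegree hr0 hr1 ha hc0 hφ φ.innerDegree_eq
  subst hδ
  refine ⟨a, ha, ?_, c, hφ⟩
  rw [← hK, ← hrα, hℓ]
  simp

end AnnulusDiskMap

/-! ### Proper maps with prescribed zeros -/

/-- The inner radii and ordered tuples of zeros of the maps in `A(e, δ)`. -/
def annulusZeros (e δ : ℕ) : Set (ℝ × (Fin e → ℂ)) :=
  {p | (0 < p.1 ∧ p.1 < 1) ∧ (∀ k, p.2 k ∈ annulus p.1) ∧ ∏ k, ‖p.2 k‖ = p.1 ^ δ}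

/-- The product of annular factors with zeros `p.2`, normalized to take the value `1` at `1`. -/
noncomputable def normalizedProduct {e : ℕ} (δ : ℕ) (p : ℝ × (Fin e → ℂ)) (z : ℂ) : ℂ :=
  (annulusProduct p.1 (-δ) p.2 1)⁻¹ * annulusProduct p.1 (-δ) p.2 z

section

variable {e δ : ℕ} {p : ℝ × (Fin e → ℂ)}

theorem isRegularTriple_of_mem_annulusZeros (hp : p ∈ annulusZeros e δ) {z : ℂ}
    (hz : z ∈ closedAnnulus p.1) (k : Fin e) : IsRegularTriple p.1 (p.2 k) z :=
  isRegularTriple_of_left_mem hp.1.1 hp.1.2 (hp.2.1 k) hz.1 hz.2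

theorem one_mem_closedAnnulus (hp : p ∈ annulusZeros e δ) : (1 : ℂ) ∈ closedAnnulus p.1 :=
  ⟨by simpa using hp.1.2.le, by simp⟩

theorem norm_normalizing_const (hp : p ∈ annulusZeros e δ) :
    ‖(annulusProduct p.1 (-δ) p.2 1)⁻¹‖ = p.1 ^ δ := by
  rw [norm_inv, norm_annulusProduct_of_norm_eq_one hp.1.1 hp.1.2 hp.2.1 norm_one, inv_inv, hp.2.2]

theorem normalizing_const_ne_zero (hp : p ∈ annulusZeros e δ) :
    (annulusProduct p.1 (-δ) p.2 1)⁻¹ ≠ 0 :=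
  norm_pos_iff.1 (norm_normalizing_const hp ▸ pow_pos hp.1.1 δ)

theorem hasZeros_normalizedProduct (hp : p ∈ annulusZeros e δ) :
    HasZeros (annulus p.1) (normalizedProduct δ p) p.2 :=
  hasZeros_annulusProduct hp.1.1 (normalizing_const_ne_zero hp)
    (fun _ hz => isRegularTriple_of_mem_annulusZeros hp (annulus_subset_closedAnnulus _ hz))
    fun _ _ => rfl

theorem differentiableAt_normalizedProduct (hp : p ∈ annulusZeros e δ) {z : ℂ}
    (hz : z ∈ closedAnnulus p.1) : DifferentiableAt ℂ (normalizedProduct δ p) z :=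
  (differentiableAt_annulusProduct _ (norm_pos_iff.1 (hp.1.1.trans_le hz.1))
    (isRegularTriple_of_mem_annulusZeros hp hz)).const_mul _

theorem norm_normalizedProduct_eq_one (hp : p ∈ annulusZeros e δ) {z : ℂ}
    (hz : z ∈ closedAnnulus p.1) (hz' : z ∉ annulus p.1) : ‖normalizedProduct δ p z‖ = 1 := by
  have hpos := (pow_pos hp.1.1 δ).ne'
  rw [normalizedProduct, norm_mul, norm_normalizing_const hp]
  by_cases h : ‖z‖ = 1
  · rw [norm_annulusProduct_of_norm_eq_one hp.1.1 hp.1.2 hp.2.1 h, hp.2.2, mul_inv_cancel₀ hpos]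
  · have h1 : ‖z‖ = p.1 := by
      by_contra h1
      exact hz' ⟨lt_of_le_of_ne hz.1 (Ne.symm h1), lt_of_le_of_ne hz.2 h⟩
    rw [norm_annulusProduct_of_norm_eq hp.1.1 hp.1.2 hp.2.1 h1, zpow_neg, zpow_natCast,
      mul_inv_cancel₀ hpos]

theorem norm_normalizedProduct_lt_one (he : 0 < e) (hp : p ∈ annulusZeros e δ) {z : ℂ}
    (hz : z ∈ annulus p.1) : ‖normalizedProduct δ p z‖ < 1 := by
  have hsub := annulus_subset_closedAnnulus p.1
  have hd : DifferentiableOn ℂ (normalizedProduct δ p) (annulus p.1) := fun w hw =>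
    (differentiableAt_normalizedProduct hp (hsub hw)).differentiableWithinAt
  have hcont : ContinuousOn (fun z => ‖normalizedProduct δ p z‖) (closedAnnulus p.1) := fun w hw =>
    (differentiableAt_normalizedProduct hp hw).continuousAt.norm.continuousWithinAt
  obtain ⟨z₀, hz₀, hmax⟩ := (isCompact_closedAnnulus p.1).exists_isMaxOn ⟨z, hsub hz⟩ hcont
  by_contra! hge
  obtain ⟨w, hw, hw1, hwmax⟩ : ∃ w ∈ annulus p.1, 1 ≤ ‖normalizedProduct δ p w‖ ∧
      ∀ v ∈ closedAnnulus p.1, ‖normalizedProduct δ p v‖ ≤ ‖normalizedProduct δ p w‖ := by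
    by_cases h : z₀ ∈ annulus p.1
    · exact ⟨z₀, h, hge.trans (hmax (hsub hz)), fun v hv => hmax hv⟩
    · refine ⟨z, hz, hge, fun v hv => (hmax hv).trans ?_⟩
      change ‖normalizedProduct δ p z₀‖ ≤ _
      rwa [norm_normalizedProduct_eq_one hp hz₀ h]
  have hconst := Complex.eqOn_of_isPreconnected_of_isMaxOn_norm (isPreconnected_annulus hp.1.1)
    (AnnulusDiskMap.isOpen_annulus p.1) hd hw fun v hv => hwmax v (hsub hv)
  have hzero : normalizedProduct δ p (p.2 ⟨0, he⟩) = 0 := by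
    obtain ⟨G, -, -, hG⟩ := hasZeros_normalizedProduct hp
    rw [hG _ (hp.2.1 _), Finset.prod_eq_zero (Finset.mem_univ ⟨0, he⟩) (sub_self _), zero_mul]
  have h1 : normalizedProduct δ p (p.2 ⟨0, he⟩) = normalizedProduct δ p w := hconst (hp.2.1 _)
  rw [← h1, hzero, norm_zero] at hw1
  linarith

/-- The proper map with given inner radius and zeros. -/
noncomputable def mapOfZeros (he : 0 < e) (p : annulusZeros e δ) : AnnulusDiskMap e δ where
  r := p.1.1
  r_pos := p.2.1.1
  r_lt_one := p.2.1.2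
  toFun := (annulus p.1.1).indicator (normalizedProduct δ p.1)
  eq_zero_of_notMem _ hz := indicator_of_notMem hz _
  holomorphic := DifferentiableOn.congr (fun w hw => (differentiableAt_normalizedProduct p.2
    (annulus_subset_closedAnnulus _ hw)).differentiableWithinAt) fun _ hz => indicator_of_mem hz _
  mapsTo z hz := by
    rw [indicator_of_mem hz]
    exact mem_ball_zero_iff.2 (norm_normalizedProduct_lt_one he p.2 hz)
  proper K hK hKc := by
    have h : annulus p.1.1 ∩ (annulus p.1.1).indicator (normalizedProduct δ p.1) ⁻¹' K =
        closedAnnulus p.1.1 ∩ normalizedProduct δ p.1 ⁻¹' K := by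
      ext z
      constructor
      · rintro ⟨hz, hzK⟩
        rw [mem_preimage, indicator_of_mem hz] at hzK
        exact ⟨annulus_subset_closedAnnulus _ hz, hzK⟩
      · rintro ⟨hz, hzK⟩
        have hz' : z ∈ annulus p.1.1 := by
          by_contra hn
          exact (mem_ball_zero_iff.1 (hK hzK)).ne (norm_normalizedProduct_eq_one p.2 hz hn)
        refine ⟨hz', ?_⟩
        rwa [mem_preimage, indicator_of_mem hz']
    rw [h]
    have hcont : ContinuousOn (normalizedProduct δ p.1) (closedAnnulus p.1.1) := fun w hw =>
      (differentiableAt_normalizedProduct p.2 hw).continuousAt.continuousWithinAt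
    exact (isCompact_closedAnnulus _).of_isClosed_subset
      (hcont.preimage_isClosed_of_isClosed (isCompact_closedAnnulus _).isClosed hKc.isClosed)
      inter_subset_left
  degree_eq := by
    obtain ⟨G, hG, hG0, hf⟩ := hasZeros_normalizedProduct p.2
    exact HasZeros.zeroCount_eq ⟨G, hG, hG0, fun z hz =>
      (indicator_of_mem hz _).trans (hf z hz)⟩ p.2.2.1
  innerDegree_eq := hasInnerDegree_of_eq_annulusProduct p.2.1.1 p.2.1.2 p.2.2.1
    (norm_normalizing_const p.2) fun _ hz => indicator_of_mem hz _
  map_one := by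
    have h := tendsto_of_eq_annulusProduct p.2.1.1 p.2.1.2 p.2.2.1
      (f := (annulus p.1.1).indicator (normalizedProduct δ p.1))
      (fun _ hz => indicator_of_mem hz _) (one_mem_closedAnnulus p.2)
    rwa [inv_mul_cancel₀ (inv_eq_zero.not.1 (normalizing_const_ne_zero p.2))] at h

theorem mapOfZeros_toFun (he : 0 < e) (p : annulusZeros e δ) {z : ℂ} (hz : z ∈ annulus p.1.1) :
    (mapOfZeros he p).toFun z = normalizedProduct δ p.1 z :=
  indicator_of_mem hz _

/-- The constant in the product formula is forced by the boundary value at `1`. -/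
theorem surjective_mapOfZeros (he : 0 < e) : Function.Surjective (mapOfZeros (δ := δ) he) := by
  intro φ
  obtain ⟨a, ha, hprod, c, hc⟩ := φ.exists_eq_annulusProduct he
  have hp : (φ.r, a) ∈ annulusZeros e δ := ⟨⟨φ.r_pos, φ.r_lt_one⟩, ha, hprod⟩
  refine ⟨⟨(φ.r, a), hp⟩, AnnulusDiskMap.ext_of_eqOn rfl fun z hz => ?_⟩
  have := neBot_nhdsWithin_annulus φ.r_pos φ.r_lt_one (ζ := 1) (Or.inr norm_one)
  have h1 : c * annulusProduct φ.r (-δ) a 1 = 1 := tendsto_nhds_unique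
    (tendsto_of_eq_annulusProduct φ.r_pos φ.r_lt_one ha hc (one_mem_closedAnnulus hp)) φ.map_one
  rw [mapOfZeros_toFun he ⟨(φ.r, a), hp⟩ hz, hc z hz, normalizedProduct,
    eq_inv_of_mul_eq_one_left h1]

theorem mapOfZeros_eq_iff (he : 0 < e) (p p' : annulusZeros e δ) :
    mapOfZeros he p = mapOfZeros he p' ↔ p.1.1 = p'.1.1 ∧ IsRearrangement p.1.2 p'.1.2 := by
  constructor
  · intro h
    have hr : p.1.1 = p'.1.1 := congrArg AnnulusDiskMap.r h
    refine ⟨hr, ?_⟩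
    obtain ⟨G, hG, hG0, hf⟩ := hasZeros_normalizedProduct p'.2
    have hz : HasZeros (annulus p'.1.1) (normalizedProduct δ p'.1) p.1.2 := by
      obtain ⟨G, hG, hG0, hf⟩ := hasZeros_normalizedProduct p.2
      rw [hr] at hG hG0 hf
      refine ⟨G, hG, hG0, fun z hz => ?_⟩
      rw [← hf z hz, ← mapOfZeros_toFun he p' hz, ← mapOfZeros_toFun he p (hr ▸ hz), h]
    exact hz.isRearrangement (hasZeros_normalizedProduct p'.2)
      (AnnulusDiskMap.isOpen_annulus _) p'.2.2.1
  · rintro ⟨hr, h⟩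
    refine AnnulusDiskMap.ext_of_eqOn hr fun z hz => ?_
    have hz' : z ∈ annulus p'.1.1 := by rw [← hr]; exact hz
    rw [mapOfZeros_toFun he p hz, mapOfZeros_toFun he p' hz', normalizedProduct,
      normalizedProduct, hr, annulusProduct_congr h, annulusProduct_congr h]

theorem continuous_mapOfZeros (he : 0 < e) : Continuous (mapOfZeros (δ := δ) he) := by
  refine continuous_iff_continuousAt.2 fun p => ?_
  have hrcont : Continuous fun s : annulusZeros e δ => s.1.1 :=
    continuous_fst.comp continuous_subtype_val
  have hr : Tendsto (fun s : annulusZeros e δ => s.1.1) (𝓝 p) (𝓝 p.1.1) := hrcont.tendsto p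
  refine (AnnulusDiskMap.tendsto_iff _ _).2 ⟨hr, fun K hK hKp => ?_⟩
  have hev : ∀ᶠ s : annulusZeros e δ in 𝓝 p, K ⊆ annulus s.1.1 := by
    obtain ⟨η, hη, h⟩ := AnnulusDiskMap.exists_subset_annulus hK hKp
    filter_upwards [Metric.tendsto_nhds.1 hr η hη] with s hs
    exact h _ (by rwa [← Real.dist_eq])
  refine ⟨hev, Metric.tendstoUniformlyOn_iff.2 fun ε hε => ?_⟩
  have hjoint : ∀ z ∈ closedAnnulus p.1.1, ContinuousAt (fun x : annulusZeros e δ × ℂ =>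
      annulusProduct x.1.1.1 (-δ) x.1.1.2 x.2) (p, z) := fun z hz =>
    ContinuousAt.comp' (f := fun x : annulusZeros e δ × ℂ => (x.1.1, x.2)) (x := (p, z))
      (continuousAt_annulusProduct (-δ) (norm_pos_iff.1 (p.2.1.1.trans_le hz.1))
        (isRegularTriple_of_mem_annulusZeros p.2 hz))
      ((continuous_subtype_val.comp continuous_fst).prodMk continuous_snd).continuousAt
  have hone : ContinuousAt (fun x : annulusZeros e δ × ℂ =>
      annulusProduct x.1.1.1 (-δ) x.1.1.2 1) (p, (0 : ℂ)) :=
    ContinuousAt.comp' (f := fun x : annulusZeros e δ × ℂ => (x.1, (1 : ℂ))) (x := (p, (0 : ℂ)))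
      (hjoint 1 (one_mem_closedAnnulus p.2)) (by fun_prop)
  have hone' : ContinuousAt (fun s : annulusZeros e δ =>
      annulusProduct s.1.1 (-δ) s.1.2 1) p :=
    ContinuousAt.comp' (f := fun s : annulusZeros e δ => (s, (1 : ℂ))) (x := p)
      (hjoint 1 (one_mem_closedAnnulus p.2)) (by fun_prop)
  have hfull : ∀ z ∈ annulus p.1.1, ContinuousAt (fun x : annulusZeros e δ × ℂ =>
      normalizedProduct δ x.1.1 x.2) (p, z) := fun z hz =>
    ((ContinuousAt.comp' (f := fun x : annulusZeros e δ × ℂ => x.1) (x := (p, z)) hone'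
      continuousAt_fst).inv₀ (inv_eq_zero.not.1 (normalizing_const_ne_zero p.2))).mul
      (hjoint z (annulus_subset_closedAnnulus _ hz))
  have huni : ∀ᶠ s in 𝓝 p, ∀ z ∈ K,
      dist (normalizedProduct δ p.1 z) (normalizedProduct δ s.1 z) < ε := by
    refine hK.eventually_forall_of_forall_eventually fun z hz => ?_
    have h1 := hfull z (hKp hz)
    have h2 : ContinuousAt (fun x : annulusZeros e δ × ℂ => normalizedProduct δ p.1 x.2) (p, z) :=
      ContinuousAt.comp' (f := fun x : annulusZeros e δ × ℂ => x.2) (x := (p, z))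
        (differentiableAt_normalizedProduct p.2
          (annulus_subset_closedAnnulus _ (hKp hz))).continuousAt continuousAt_snd
    have h3 := h2.dist h1
    exact h3.eventually_lt continuousAt_const (by simpa using hε)
  filter_upwards [hev, huni] with s hs1 hs2 z hz
  rw [mapOfZeros_toFun he p (hKp hz), mapOfZeros_toFun he s (hs1 hz)]
  exact hs2 z hz

/-- If proper maps of degree `e` converge to one of the same degree, then every limit point of their
zeros lies in the open annulus: zeros escaping to the boundary are lost in the limit. -/
theorem isProperMap_mapOfZeros (he : 0 < e) : IsProperMap (mapOfZeros (δ := δ) he) := by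
  refine isProperMap_iff_ultrafilter.2 ⟨continuous_mapOfZeros he, fun 𝒰 φ hφ => ?_⟩
  obtain ⟨p, rfl⟩ := surjective_mapOfZeros he φ
  obtain ⟨hr, hK⟩ := (AnnulusDiskMap.tendsto_iff _ _).1 hφ
  change Tendsto (fun s : annulusZeros e δ => s.1.1) 𝒰 (𝓝 p.1.1) at hr
  have hr0 := p.2.1.1
  have hr1 := p.2.1.2
  obtain ⟨a, haK, ha⟩ := exists_tendsto_of_mem_isCompact
    (isCompact_closedBall (0 : Fin e → ℂ) 1) 𝒰 (fun s : annulusZeros e δ => s.1.2) fun s => by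
      rw [mem_closedBall_zero_iff, pi_norm_le_iff_of_nonneg zero_le_one]
      exact fun k => (s.2.2.1 k).2.le
  have hak : ∀ k, Tendsto (fun s : annulusZeros e δ => s.1.2 k) 𝒰 (𝓝 (a k)) := fun k =>
    ((continuous_apply k).tendsto a).comp ha
  have hac : ∀ k, a k ∈ closedAnnulus p.1.1 := fun k =>
    ⟨le_of_tendsto_of_tendsto' hr (hak k).norm fun s => (s.2.2.1 k).1.le,
      le_of_tendsto' (hak k).norm fun s => (s.2.2.1 k).2.le⟩
  have hnorm : ∀ s : annulusZeros e δ, ‖(annulusProduct s.1.1 (-δ) s.1.2 1)⁻¹‖ = s.1.1 ^ δ :=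
    fun s => norm_normalizing_const s.2
  obtain ⟨c, -, hc⟩ := exists_tendsto_of_mem_isCompact
    (isCompact_closedBall (0 : ℂ) 1) 𝒰
    (fun s : annulusZeros e δ => (annulusProduct s.1.1 (-δ) s.1.2 1)⁻¹) fun s => by
      rw [mem_closedBall_zero_iff, hnorm]
      exact pow_le_one₀ s.2.1.1.le s.2.1.2.le
  have hc0 : c ≠ 0 := by
    have h1 := hc.norm
    simp only [hnorm] at h1
    have h2 := tendsto_nhds_unique h1 (hr.pow δ)
    exact norm_pos_iff.1 (h2 ▸ pow_pos hr0 δ)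
  have hreg : ∀ z ∈ annulus p.1.1, ∀ k, IsRegularTriple p.1.1 (a k) z := fun z hz k =>
    (isRegularTriple_of_left_mem hr0 hr1 hz (hac k).1 (hac k).2).symm
  have heq : ∀ z ∈ annulus p.1.1, normalizedProduct δ p.1 z =
      c * annulusProduct p.1.1 (-δ) a z := by
    intro z hz
    obtain ⟨hev, huni⟩ := hK {z} isCompact_singleton (singleton_subset_iff.2 hz)
    have h1 := huni.tendsto_at (mem_singleton z)
    rw [mapOfZeros_toFun he p hz] at h1
    refine tendsto_nhds_unique h1 ?_
    have h2 : Tendsto (fun s : annulusZeros e δ => annulusProduct s.1.1 (-δ) s.1.2 z) 𝒰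
        (𝓝 (annulusProduct p.1.1 (-δ) a z)) := by
      have hcont := continuousAt_annulusProduct (-δ) (ne_zero_of_mem_annulus hr0 hz) (hreg z hz)
      exact hcont.tendsto.comp ((hr.prodMk_nhds ha).prodMk_nhds tendsto_const_nhds)
    refine (hc.mul h2).congr' ?_
    filter_upwards [hev] with s hs
    rw [mapOfZeros_toFun he s (hs (mem_singleton z))]
    rfl
  have hre : IsRearrangement a p.1.2 := (hasZeros_annulusProduct hr0 hc0 hreg heq).isRearrangement
    (hasZeros_normalizedProduct p.2) (AnnulusDiskMap.isOpen_annulus _) p.2.2.1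
  have hmem : (p.1.1, a) ∈ annulusZeros e δ := by
    refine ⟨p.2.1, ?_, (hre.prod_eq fun w => ‖w‖).trans p.2.2.2⟩
    obtain ⟨σ, hσ⟩ := hre
    rw [hσ]
    exact fun k => p.2.2.1 (σ k)
  refine ⟨⟨(p.1.1, a), hmem⟩, (mapOfZeros_eq_iff he _ _).2 ⟨rfl, hre⟩, ?_⟩
  exact (tendsto_subtype_rng (f := id)).2 (hr.prodMk_nhds ha)

end

/-! ### The space of zeros of annulus-disk maps -/

/-- The gauge of the cube `(-p, 1 - p)^e`, for `0 < p < 1`. -/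
noncomputable def cubeGauge {e : ℕ} (p : ℝ) (s : Fin e → ℝ) : ℝ :=
  ‖fun k => max (s k / (1 - p)) (-s k / p)‖

theorem cubeGauge_nonneg {e : ℕ} (p : ℝ) (s : Fin e → ℝ) : 0 ≤ cubeGauge p s := norm_nonneg _

theorem continuous_cubeGauge {e : ℕ} (p : ℝ) : Continuous (cubeGauge (e := e) p) := by
  unfold cubeGauge
  refine Continuous.norm (continuous_pi fun k => ?_)
  exact ((continuous_apply k).div_const _).max ((continuous_apply k).neg.div_const _)

theorem cubeGauge_smul {e : ℕ} (p : ℝ) (s : Fin e → ℝ) {c : ℝ} (hc : 0 ≤ c) :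
    cubeGauge p (c • s) = c * cubeGauge p s := by
  have h : (fun k => max ((c • s) k / (1 - p)) (-(c • s) k / p)) =
      c • fun k => max (s k / (1 - p)) (-s k / p) := by
    ext k
    simp only [Pi.smul_apply, smul_eq_mul]
    rw [mul_max_of_nonneg _ _ hc]
    congr 1 <;> ring
  unfold cubeGauge
  rw [h, norm_smul, Real.norm_of_nonneg hc]

theorem cubeGauge_lt_one_iff {e : ℕ} {p : ℝ} (hp0 : 0 < p) (hp1 : p < 1) (s : Fin e → ℝ) :
    cubeGauge p s < 1 ↔ ∀ k, -p < s k ∧ s k < 1 - p := by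
  unfold cubeGauge
  rw [pi_norm_lt_iff one_pos]
  refine forall_congr' fun k => ?_
  have hp : 0 < 1 - p := by linarith
  have h0 : 0 ≤ max (s k / (1 - p)) (-s k / p) := by
    rcases le_total 0 (s k) with h | h
    · exact le_max_of_le_left (div_nonneg h hp.le)
    · exact le_max_of_le_right (div_nonneg (neg_nonneg.2 h) hp0.le)
  rw [Real.norm_of_nonneg h0, max_lt_iff, div_lt_one hp, div_lt_one hp0]
  constructor <;> rintro ⟨h1, h2⟩ <;> constructor <;> linarith

theorem cubeGauge_comp_perm {e : ℕ} (p : ℝ) (s : Fin e → ℝ) (σ : Equiv.Perm (Fin e)) :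
    cubeGauge p (s ∘ σ) = cubeGauge p s :=
  IsRearrangement.norm_eq ⟨σ, rfl⟩

/-- Radial expansion of the cube `(-p, 1 - p)^e` onto the whole space. -/
noncomputable def cubeExpand {e : ℕ} (p : ℝ) (s : Fin e → ℝ) : Fin e → ℝ :=
  (1 - cubeGauge p s)⁻¹ • s

/-- The inverse of `cubeExpand`. -/
noncomputable def cubeContract {e : ℕ} (p : ℝ) (t : Fin e → ℝ) : Fin e → ℝ :=
  (1 + cubeGauge p t)⁻¹ • t

theorem cubeContract_cubeExpand {e : ℕ} {p : ℝ} {s : Fin e → ℝ} (hs : cubeGauge p s < 1) :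
    cubeContract p (cubeExpand p s) = s := by
  have h1 : 0 < 1 - cubeGauge p s := by linarith
  unfold cubeContract cubeExpand
  rw [cubeGauge_smul p s (inv_nonneg.2 h1.le), smul_smul]
  convert one_smul ℝ s using 2
  field_simp
  ring

theorem cubeExpand_cubeContract {e : ℕ} (p : ℝ) (t : Fin e → ℝ) :
    cubeExpand p (cubeContract p t) = t := by
  have h1 : 0 < 1 + cubeGauge p t := by linarith [cubeGauge_nonneg p t]
  unfold cubeContract cubeExpand
  rw [cubeGauge_smul p t (inv_nonneg.2 h1.le), smul_smul]
  convert one_smul ℝ t using 2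
  field_simp
  ring

theorem cubeGauge_cubeContract_lt_one {e : ℕ} (p : ℝ) (t : Fin e → ℝ) :
    cubeGauge p (cubeContract p t) < 1 := by
  have h1 : 0 < 1 + cubeGauge p t := by linarith [cubeGauge_nonneg p t]
  unfold cubeContract
  rw [cubeGauge_smul p t (inv_nonneg.2 h1.le), inv_mul_lt_one₀ h1]
  linarith

theorem continuousOn_cubeExpand {e : ℕ} (p : ℝ) :
    ContinuousOn (cubeExpand (e := e) p) {s | cubeGauge p s < 1} :=
  ((continuous_const.sub (continuous_cubeGauge p)).continuousOn.inv₀ fun s hs =>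
    (sub_pos.2 (show cubeGauge p s < 1 from hs)).ne').smul continuousOn_id

theorem continuous_cubeContract {e : ℕ} (p : ℝ) : Continuous (cubeContract (e := e) p) :=
  ((continuous_const.add (continuous_cubeGauge p)).inv₀ fun t =>
    (by linarith [cubeGauge_nonneg p t] : 0 < 1 + cubeGauge p t).ne').smul continuous_id

/-- The complex number with the argument of `u` and modulus `exp t`. -/
noncomputable def withLogNorm (u : ℂ) (t : ℝ) : ℂ := u / (‖u‖ : ℂ) * (Real.exp t : ℂ)

theorem norm_withLogNorm {u : ℂ} (hu : u ≠ 0) (t : ℝ) : ‖withLogNorm u t‖ = Real.exp t := by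
  rw [withLogNorm, norm_mul, norm_div, Complex.norm_real, Complex.norm_real, norm_norm,
    div_self (norm_ne_zero_iff.2 hu), one_mul, Real.norm_of_nonneg (Real.exp_pos t).le]

theorem withLogNorm_withLogNorm {u : ℂ} (hu : u ≠ 0) (t t' : ℝ) :
    withLogNorm (withLogNorm u t) t' = withLogNorm u t' := by
  have h : (Real.exp t : ℂ) ≠ 0 := by exact_mod_cast (Real.exp_pos t).ne'
  conv_lhs => rw [withLogNorm, norm_withLogNorm hu, withLogNorm, mul_div_cancel_right₀ _ h]
  rfl

theorem withLogNorm_log_norm {u : ℂ} (hu : u ≠ 0) : withLogNorm u (Real.log ‖u‖) = u := by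
  have h : (‖u‖ : ℂ) ≠ 0 := by exact_mod_cast norm_ne_zero_iff.2 hu
  rw [withLogNorm, Real.exp_log (norm_pos_iff.2 hu), div_mul_cancel₀ _ h]

theorem continuousAt_withLogNorm {u : ℂ} (hu : u ≠ 0) (t : ℝ) :
    ContinuousAt (fun x : ℂ × ℝ => withLogNorm x.1 x.2) (u, t) := by
  have h : (‖u‖ : ℂ) ≠ 0 := by exact_mod_cast norm_ne_zero_iff.2 hu
  refine ContinuousAt.mul (continuousAt_fst.div ?_ h) ?_
  · exact (continuous_ofReal.comp continuous_fst.norm).continuousAt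
  · exact (continuous_ofReal.comp (Real.continuous_exp.comp continuous_snd)).continuousAt

/-- The logarithms of the moduli `‖a k‖` to base `r`, shifted by `p`. -/
noncomputable def logHeights {e : ℕ} (p r : ℝ) (a : Fin e → ℂ) (k : Fin e) : ℝ :=
  Real.log ‖a k‖ / Real.log r - p

/-- Moves the moduli of a tuple in `𝔸_r` by the radial expansion of the cube of logarithmic
moduli. -/
noncomputable def spreadModuli {e : ℕ} (p r : ℝ) (a : Fin e → ℂ) (k : Fin e) : ℂ :=
  withLogNorm (a k) (cubeExpand p (logHeights p r a) k)

/-- The inverse of `spreadModuli`, where `u = log r`. -/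
noncomputable def squeezeModuli {e : ℕ} (p u : ℝ) (b : Fin e → ℂ) (k : Fin e) : ℂ :=
  withLogNorm (b k) ((cubeContract p (fun j => Real.log ‖b j‖) k + p) * u)

theorem spreadModuli_comp_perm {e : ℕ} (p r : ℝ) (a : Fin e → ℂ) (σ : Equiv.Perm (Fin e)) :
    spreadModuli p r (a ∘ σ) = spreadModuli p r a ∘ σ := by
  have h : logHeights p r (a ∘ σ) = logHeights p r a ∘ σ := rfl
  ext k
  simp only [spreadModuli, h, cubeExpand, cubeGauge_comp_perm, Function.comp_apply, Pi.smul_apply]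

theorem squeezeModuli_comp_perm {e : ℕ} (p u : ℝ) (b : Fin e → ℂ) (σ : Equiv.Perm (Fin e)) :
    squeezeModuli p u (b ∘ σ) = squeezeModuli p u b ∘ σ := by
  have h : cubeContract p (fun j => Real.log ‖(b ∘ σ) j‖) =
      cubeContract p (fun j => Real.log ‖b j‖) ∘ σ := by
    change cubeContract p ((fun j => Real.log ‖b j‖) ∘ σ) = _
    unfold cubeContract
    rw [cubeGauge_comp_perm]
    rfl
  ext k
  rw [squeezeModuli, h]
  rfl

section

variable {e δ : ℕ}

theorem norm_coeffsOfRoots_zero (he : 0 < e) (b : Fin e → ℂ) :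
    ‖coeffsOfRoots b ⟨0, he⟩‖ = ∏ k, ‖b k‖ := by
  rw [coeffsOfRoots_zero, norm_prod]
  simp only [norm_neg]

theorem ne_zero_of_prod_norm_eq_one {b : Fin e → ℂ} (hb : ∏ k, ‖b k‖ = 1) (k : Fin e) :
    b k ≠ 0 := by
  intro h
  rw [Finset.prod_eq_zero (Finset.mem_univ k) (by rw [h, norm_zero])] at hb
  exact zero_ne_one hb

theorem cubeGauge_logHeights_lt_one (hδ : 0 < δ) (hδe : δ < e) {x : ℝ × (Fin e → ℂ)}
    (hx : x ∈ annulusZeros e δ) : cubeGauge (δ / e : ℝ) (logHeights (δ / e) x.1 x.2) < 1 := by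
  have he' : (0 : ℝ) < e := by exact_mod_cast hδ.trans hδe
  have hp0 : (0 : ℝ) < δ / e := div_pos (by exact_mod_cast hδ) he'
  have hp1 : (δ / e : ℝ) < 1 := (div_lt_one he').2 (by exact_mod_cast hδe)
  have hlog := Real.log_neg hx.1.1 hx.1.2
  refine (cubeGauge_lt_one_iff hp0 hp1 _).2 fun k => ?_
  have h1 := Real.log_lt_log hx.1.1 (hx.2.1 k).1
  have h2 := Real.log_neg (hx.1.1.trans (hx.2.1 k).1) (hx.2.1 k).2
  have h3 : 0 < Real.log ‖x.2 k‖ / Real.log x.1 := div_pos_of_neg_of_neg h2 hlog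
  have h4 : Real.log ‖x.2 k‖ / Real.log x.1 < 1 := (div_lt_one_of_neg hlog).2 h1
  unfold logHeights
  constructor <;> linarith

theorem sum_logHeights (he : 0 < e) {x : ℝ × (Fin e → ℂ)} (hx : x ∈ annulusZeros e δ) :
    ∑ k, logHeights (δ / e) x.1 x.2 k = 0 := by
  have he' : (e : ℝ) ≠ 0 := by exact_mod_cast he.ne'
  have hlog := (Real.log_neg hx.1.1 hx.1.2).ne
  unfold logHeights
  rw [Finset.sum_sub_distrib, ← Finset.sum_div, ← Real.log_prod fun k _ =>
    (hx.1.1.trans (hx.2.1 k).1).ne', hx.2.2, Real.log_pow]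
  simp
  field_simp
  ring

theorem prod_norm_spreadModuli (he : 0 < e) {x : ℝ × (Fin e → ℂ)} (hx : x ∈ annulusZeros e δ) :
    ∏ k, ‖spreadModuli (δ / e) x.1 x.2 k‖ = 1 := by
  have h : ∀ k, ‖spreadModuli (δ / e) x.1 x.2 k‖ =
      Real.exp (cubeExpand (δ / e) (logHeights (δ / e) x.1 x.2) k) := fun k =>
    norm_withLogNorm (ne_zero_of_mem_annulus hx.1.1 (hx.2.1 k)) _
  simp only [h]
  rw [← Real.exp_sum]
  simp only [cubeExpand, Pi.smul_apply]
  rw [← Finset.smul_sum, sum_logHeights he hx, smul_zero, Real.exp_zero]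

theorem squeezeModuli_mem (hδ : 0 < δ) (hδe : δ < e) {b : Fin e → ℂ} (hb : ∏ k, ‖b k‖ = 1)
    {u : ℝ} (hu : u < 0) : (Real.exp u, squeezeModuli (δ / e) u b) ∈ annulusZeros e δ := by
  have he' : (0 : ℝ) < e := by exact_mod_cast hδ.trans hδe
  have hp0 : (0 : ℝ) < δ / e := div_pos (by exact_mod_cast hδ) he'
  have hp1 : (δ / e : ℝ) < 1 := (div_lt_one he').2 (by exact_mod_cast hδe)
  have hnorm : ∀ k, ‖squeezeModuli (δ / e) u b k‖ =
      Real.exp ((cubeContract (δ / e) (fun j => Real.log ‖b j‖) k + δ / e) * u) := fun k =>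
    norm_withLogNorm (ne_zero_of_prod_norm_eq_one hb k) _
  have hlt := (cubeGauge_lt_one_iff hp0 hp1 _).1
    (cubeGauge_cubeContract_lt_one (δ / e : ℝ) fun j => Real.log ‖b j‖)
  refine ⟨⟨Real.exp_pos u, by simpa using hu⟩, fun k => ⟨?_, ?_⟩, ?_⟩
  · simp only [hnorm]
    refine Real.exp_lt_exp.2 ?_
    nlinarith [(hlt k).2]
  · simp only [hnorm]
    rw [Real.exp_lt_one_iff]
    exact mul_neg_of_pos_of_neg (by linarith [(hlt k).1]) hu
  · simp only [hnorm]
    rw [← Real.exp_sum, ← Real.exp_nat_mul, ← Finset.sum_mul, Finset.sum_add_distrib]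
    have h0 : ∑ k, cubeContract (δ / e : ℝ) (fun j => Real.log ‖b j‖) k = 0 := by
      simp only [cubeContract, Pi.smul_apply]
      rw [← Finset.smul_sum, ← Real.log_prod fun k _ =>
        norm_ne_zero_iff.2 (ne_zero_of_prod_norm_eq_one hb k), hb, Real.log_one, smul_zero]
    rw [h0]
    simp
    left
    field_simp

/-- The inner radius is a free parameter, and the constraint on the zeros is that the logarithmic
moduli `log ‖a k‖ / log r` form a point of the cube `(0, 1)^e` on the hyperplane with sum `δ`. This
slice of the cube is expanded radially, from its centre, to the whole hyperplane. -/
noncomputable def annulusZerosHomeomorph (hδ : 0 < δ) (hδe : δ < e) :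
    annulusZeros e δ ≃ₜ ℝ × {b : Fin e → ℂ // ∏ k, ‖b k‖ = 1} where
  toFun x := (Real.log (-Real.log x.1.1),
    ⟨spreadModuli (δ / e) x.1.1 x.1.2, prod_norm_spreadModuli (hδ.trans hδe) x.2⟩)
  invFun y := ⟨(Real.exp (-Real.exp y.1), squeezeModuli (δ / e) (-Real.exp y.1) y.2.1),
    squeezeModuli_mem hδ hδe y.2.2 (neg_lt_zero.2 (Real.exp_pos _))⟩
  left_inv := by
    rintro ⟨⟨r, a⟩, hx⟩
    have hlog : Real.log r < 0 := Real.log_neg hx.1.1 hx.1.2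
    have ha : ∀ k, a k ≠ 0 := fun k => ne_zero_of_mem_annulus hx.1.1 (hx.2.1 k)
    have hu : -Real.exp (Real.log (-Real.log r)) = Real.log r := by
      rw [Real.exp_log (neg_pos.2 hlog), neg_neg]
    refine Subtype.ext (Prod.ext ?_ (funext fun k => ?_))
    · simp only [hu]
      exact Real.exp_log hx.1.1
    · simp only [hu]
      have h1 : (fun j => Real.log ‖spreadModuli (δ / e) r a j‖) =
          cubeExpand (δ / e) (logHeights (δ / e) r a) := by
        ext j
        rw [spreadModuli, norm_withLogNorm (ha j), Real.log_exp]
      rw [squeezeModuli, h1, cubeContract_cubeExpand (cubeGauge_logHeights_lt_one hδ hδe hx),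
        spreadModuli, withLogNorm_withLogNorm (ha k), logHeights, sub_add_cancel,
        div_mul_cancel₀ _ hlog.ne, withLogNorm_log_norm (ha k)]
  right_inv := by
    rintro ⟨ρ, b, hb⟩
    have hb0 := ne_zero_of_prod_norm_eq_one hb
    have hu : -Real.exp ρ ≠ 0 := neg_ne_zero.2 (Real.exp_pos _).ne'
    refine Prod.ext ?_ (Subtype.ext (funext fun k => ?_))
    · simp
    · have h1 : logHeights (δ / e) (Real.exp (-Real.exp ρ))
          (squeezeModuli (δ / e) (-Real.exp ρ) b) =
          cubeContract (δ / e) (fun j => Real.log ‖b j‖) := by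
        ext j
        rw [logHeights, squeezeModuli, norm_withLogNorm (hb0 j), Real.log_exp, Real.log_exp,
          mul_div_cancel_right₀ _ hu, add_sub_cancel_right]
      simp only
      rw [spreadModuli, h1, cubeExpand_cubeContract, squeezeModuli,
        withLogNorm_withLogNorm (hb0 k), withLogNorm_log_norm (hb0 k)]
  continuous_toFun := by
    have hr : Continuous fun x : annulusZeros e δ => x.1.1 :=
      continuous_fst.comp continuous_subtype_val
    have ha : ∀ k, Continuous fun x : annulusZeros e δ => x.1.2 k := fun k =>
      (continuous_apply k).comp (continuous_snd.comp continuous_subtype_val)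
    have hlog : Continuous fun x : annulusZeros e δ => Real.log x.1.1 :=
      hr.log fun x => x.2.1.1.ne'
    have hlogneg : ∀ x : annulusZeros e δ, Real.log x.1.1 < 0 := fun x =>
      Real.log_neg x.2.1.1 x.2.1.2
    have hheights : Continuous fun x : annulusZeros e δ => logHeights (δ / e) x.1.1 x.1.2 := by
      refine continuous_pi fun k => (Continuous.div ((ha k).norm.log fun x => ?_) hlog
        fun x => (hlogneg x).ne).sub continuous_const
      exact norm_ne_zero_iff.2 (ne_zero_of_mem_annulus x.2.1.1 (x.2.2.1 k))
    refine (hlog.neg.log fun x => (neg_pos.2 (hlogneg x)).ne').prodMk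
      (Continuous.subtype_mk (continuous_pi fun k => ?_) _)
    refine continuous_iff_continuousAt.2 fun x => ?_
    have hexp : Continuous fun x : annulusZeros e δ =>
        cubeExpand (δ / e) (logHeights (δ / e) x.1.1 x.1.2) k :=
      (continuous_apply k).comp ((continuousOn_cubeExpand (δ / e : ℝ)).comp_continuous hheights
        fun x => cubeGauge_logHeights_lt_one hδ hδe x.2)
    exact ContinuousAt.comp' (x := x)
      (continuousAt_withLogNorm (ne_zero_of_mem_annulus x.2.1.1 (x.2.2.1 k)) _)
      ((ha k).prodMk hexp).continuousAt
  continuous_invFun := by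
    have hu : Continuous fun y : ℝ × {b : Fin e → ℂ // ∏ k, ‖b k‖ = 1} => -Real.exp y.1 :=
      (Real.continuous_exp.comp continuous_fst).neg
    have hb : ∀ k, Continuous fun y : ℝ × {b : Fin e → ℂ // ∏ k, ‖b k‖ = 1} => y.2.1 k := fun k =>
      (continuous_apply k).comp (continuous_subtype_val.comp continuous_snd)
    refine Continuous.subtype_mk
      ((Real.continuous_exp.comp hu).prodMk (continuous_pi fun k => ?_)) _
    refine continuous_iff_continuousAt.2 fun y => ?_
    have hlog : Continuous fun y : ℝ × {b : Fin e → ℂ // ∏ k, ‖b k‖ = 1} =>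
        fun j => Real.log ‖y.2.1 j‖ := continuous_pi fun j => (hb j).norm.log fun y =>
      norm_ne_zero_iff.2 (ne_zero_of_prod_norm_eq_one y.2.2 j)
    have hc := (continuous_apply k).comp ((continuous_cubeContract (δ / e : ℝ)).comp hlog)
    exact ContinuousAt.comp' (x := y)
      (continuousAt_withLogNorm (ne_zero_of_prod_norm_eq_one y.2.2 k) _)
      ((hb k).prodMk ((hc.add continuous_const).mul hu)).continuousAt

theorem annulusZerosHomeomorph_rearrangement_iff (hδ : 0 < δ) (hδe : δ < e)
    (x x' : annulusZeros e δ) :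
    ((annulusZerosHomeomorph hδ hδe x).1 = (annulusZerosHomeomorph hδ hδe x').1 ∧
      IsRearrangement (annulusZerosHomeomorph hδ hδe x).2.1
        (annulusZerosHomeomorph hδ hδe x').2.1) ↔
      x.1.1 = x'.1.1 ∧ IsRearrangement x.1.2 x'.1.2 := by
  constructor
  · rintro ⟨h1, σ, hσ⟩
    have key : ∀ x, (Real.exp (-Real.exp (annulusZerosHomeomorph hδ hδe x).1),
        squeezeModuli (δ / e) (-Real.exp (annulusZerosHomeomorph hδ hδe x).1)
          (annulusZerosHomeomorph hδ hδe x).2.1) = x.1 := fun x =>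
      congrArg Subtype.val ((annulusZerosHomeomorph hδ hδe).left_inv x)
    rw [← key x, ← key x', h1, hσ]
    exact ⟨rfl, σ, squeezeModuli_comp_perm _ _ _ σ⟩
  · rintro ⟨h1, σ, hσ⟩
    refine ⟨congrArg (fun r => Real.log (-Real.log r)) h1, σ, ?_⟩
    change spreadModuli _ x.1.1 x.1.2 = spreadModuli _ x'.1.1 x'.1.2 ∘ σ
    rw [h1, hσ, spreadModuli_comp_perm]

/-- `Circle` as a subset of the plane. -/
noncomputable def sphereHomeomorphCircle : Metric.sphere (0 : ℂ) 1 ≃ₜ Circle where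
  toFun z := ⟨z.1, z.2⟩
  invFun z := ⟨z.1, z.2⟩
  left_inv _ := rfl
  right_inv _ := rfl
  continuous_toFun := continuous_id
  continuous_invFun := continuous_id

theorem nonempty_annulusDiskMap_homeomorph (hδ : 0 < δ) (hδe : δ < e) :
    Nonempty (AnnulusDiskMap e δ ≃ₜ EuclideanSpace ℝ (Fin (2 * e - 1)) × Circle) := by
  have he := hδ.trans hδe
  set i : Fin e := ⟨0, he⟩
  set W : Set (Fin e → ℂ) := {c | c i ∈ Metric.sphere (0 : ℂ) 1} with hW
  have hpre : {b : Fin e → ℂ | ∏ k, ‖b k‖ = 1} = coeffsOfRoots ⁻¹' W := by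
    ext b
    rw [mem_preimage, hW, mem_ofPred_eq, mem_ofPred_eq, mem_sphere_zero_iff_norm,
      norm_coeffsOfRoots_zero]
  have hp := isProperMap_mapOfZeros (δ := δ) he
  have hq : IsProperMap (Prod.map (id : ℝ → ℝ) (W.restrictPreimage coeffsOfRoots)) :=
    isProperMap_id.prodMap (isProperMap_coeffsOfRoots.restrictPreimage W)
  obtain ⟨h⟩ := nonempty_homeomorph_of_isQuotientMap
    (hp.isClosedMap.isQuotientMap hp.continuous (surjective_mapOfZeros he))
    (hq.isClosedMap.isQuotientMap hq.continuous (Function.surjective_id.prodMap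
      (W.restrictPreimage_surjective surjective_coeffsOfRoots)))
    ((annulusZerosHomeomorph hδ hδe).trans
      ((Homeomorph.refl ℝ).prodCongr (Homeomorph.setCongr hpre))) fun x x' => by
      rw [mapOfZeros_eq_iff, ← annulusZerosHomeomorph_rearrangement_iff hδ hδe,
        ← coeffsOfRoots_eq_iff, Prod.ext_iff, Subtype.ext_iff]
      rfl
  have hdim : Module.finrank ℝ (ℝ × ({j // j ≠ i} → ℂ)) =
      Module.finrank ℝ (EuclideanSpace ℝ (Fin (2 * e - 1))) := by
    rw [Module.finrank_prod, finrank_complex_pi_ne, finrank_euclideanSpace_fin,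
      Module.finrank_self]
    omega
  have h1 : ℝ × W ≃ₜ ℝ × (({j // j ≠ i} → ℂ) × Circle) :=
    (Homeomorph.refl ℝ).prodCongr ((coordinateSliceHomeomorph i _).trans
      ((Homeomorph.prodComm _ _).trans ((Homeomorph.refl _).prodCongr sphereHomeomorphCircle)))
  exact ⟨(h.trans h1).trans ((Homeomorph.prodAssoc _ _ _).symm.trans
    ((ContinuousLinearEquiv.ofFinrankEq hdim).toHomeomorph.prodCongr (Homeomorph.refl _)))⟩

end

/-! ### The model space -/

theorem Admissible.two_le {n : ℕ} {d : Fin (n + 1) → ℕ} (hd : Admissible d) (k : Fin (n + 1)) :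
    2 ≤ d k := by
  by_contra! hlt
  have h1 : d k = 1 := by have := hd.1 k; omega
  have h2 : (1 : ℝ) / d k ≤ ∑ j, (1 : ℝ) / d j :=
    Finset.single_le_sum (f := fun j => (1 : ℝ) / d j) (fun j _ => by positivity)
      (Finset.mem_univ k)
  rw [h1] at h2
  have := hd.2
  norm_num at h2
  norm_num at this
  linarith

theorem nonempty_blaschkeAtInfinity_homeomorph (σ : SchemeType) {D : ℕ} (hD : 0 < D) :
    Nonempty (BlaschkeAtInfinity σ D ≃ₜ EuclideanSpace ℝ (Fin (2 * D - 2))) := by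
  cases σ
  · exact nonempty_blaschkeZC_homeomorph hD
  · exact nonempty_blaschkeFC_homeomorph hD
  · exact nonempty_blaschkeFC_homeomorph hD

theorem sum_castSucc_add_succ {n : ℕ} (d : Fin (n + 1) → ℕ) :
    ∑ k : Fin n, (d k.castSucc + d k.succ) + d 0 + d (Fin.last n) = 2 * ∑ k, d k := by
  rw [Finset.sum_add_distrib]
  have h1 := Fin.sum_univ_castSucc d
  have h2 := Fin.sum_univ_succ d
  omega

/-- The splitting of a product of products. -/
def piProdHomeomorph {ι : Type*} (X Y : ι → Type*) [∀ i, TopologicalSpace (X i)]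
    [∀ i, TopologicalSpace (Y i)] : (∀ i, X i × Y i) ≃ₜ (∀ i, X i) × (∀ i, Y i) where
  toFun f := (fun i => (f i).1, fun i => (f i).2)
  invFun g := fun i => (g.1 i, g.2 i)
  left_inv _ := rfl
  right_inv _ := rfl
  continuous_toFun := by fun_prop
  continuous_invFun := by fun_prop

end CantorCircle

theorem corollary5p3 (σ : CantorCircle.SchemeType) (n : ℕ) (hn : 1 ≤ n) (d : Fin (n + 1) → ℕ)
    (hd : CantorCircle.Admissible d) (χ : Fin n → CantorCircle.Side) :
    Nonempty (CantorCircle.ModelSpace σ d χ ≃ₜ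
      EuclideanSpace ℝ (Fin (4 * (∑ k, d k) - 4 - n)) × (Fin n → Circle)) ∧
    Nonempty (CantorCircle.BlaschkeFC (d 0) ≃ₜ EuclideanSpace ℝ (Fin (2 * d 0 - 2))) ∧
    Nonempty (CantorCircle.BlaschkeAtInfinity σ (d (Fin.last n)) ≃ₜ
      EuclideanSpace ℝ (Fin (2 * d (Fin.last n) - 2))) ∧
    ∀ k : Fin n, Nonempty
      (CantorCircle.AnnulusDiskMap (d k.castSucc + d k.succ) (CantorCircle.innerDegree d χ k) ≃ₜ
        EuclideanSpace ℝ (Fin (2 * (d k.castSucc + d k.succ) - 1)) × Circle) := by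
  have h2 := hd.two_le
  have hA := CantorCircle.nonempty_blaschkeFC_homeomorph (D := d 0) (by linarith [h2 0])
  have hB := CantorCircle.nonempty_blaschkeAtInfinity_homeomorph σ (D := d (Fin.last n))
    (by linarith [h2 (Fin.last n)])
  have hC : ∀ k : Fin n, Nonempty
      (CantorCircle.AnnulusDiskMap (d k.castSucc + d k.succ) (CantorCircle.innerDegree d χ k) ≃ₜ
        EuclideanSpace ℝ (Fin (2 * (d k.castSucc + d k.succ) - 1)) × Circle) := by
    intro k
    have h3 := h2 k.castSucc
    have h4 := h2 k.succ
    refine CantorCircle.nonempty_annulusDiskMap_homeomorph ?_ ?_ <;>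
      unfold CantorCircle.innerDegree <;> split <;> omega
  refine ⟨?_, hA, hB, hC⟩
  obtain ⟨eA⟩ := hA
  obtain ⟨eB⟩ := hB
  have hdim : Module.finrank ℝ (EuclideanSpace ℝ (Fin (2 * d 0 - 2)) ×
      EuclideanSpace ℝ (Fin (2 * d (Fin.last n) - 2)) ×
      (∀ k : Fin n, EuclideanSpace ℝ (Fin (2 * (d k.castSucc + d k.succ) - 1)))) =
      Module.finrank ℝ (EuclideanSpace ℝ (Fin (4 * (∑ k, d k) - 4 - n))) := by
    rw [Module.finrank_prod, Module.finrank_prod, Module.finrank_pi_fintype]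
    simp only [finrank_euclideanSpace_fin]
    have h3 : ∑ k : Fin n, (2 * (d k.castSucc + d k.succ) - 1) + n =
        2 * ∑ k : Fin n, (d k.castSucc + d k.succ) := by
      have h4 : ∑ k : Fin n, ((2 * (d k.castSucc + d k.succ) - 1) + 1) =
          ∑ k : Fin n, 2 * (d k.castSucc + d k.succ) :=
        Finset.sum_congr rfl fun k _ => by have := h2 k.castSucc; omega
      rw [Finset.sum_add_distrib, ← Finset.mul_sum] at h4
      simpa using h4
    have h5 := CantorCircle.sum_castSucc_add_succ d
    have h6 := h2 0
    have h7 := h2 (Fin.last n)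
    omega
  refine ⟨(eA.prodCongr (eB.prodCongr ((Homeomorph.piCongrRight fun k => (hC k).some).trans
    (CantorCircle.piProdHomeomorph _ _)))).trans ?_⟩
  refine (((Homeomorph.refl _).prodCongr (Homeomorph.prodAssoc _ _ _).symm).trans
    (Homeomorph.prodAssoc _ _ _).symm).trans ?_
  exact (ContinuousLinearEquiv.ofFinrankEq hdim).toHomeomorph.prodCongr (Homeomorph.refl _)
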